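/- **Setting.** For every $h>0$ let $\Gamma_h=(V_h,E_h)$ be an infinite, locally finite planar graph embedded in $\mathbb C$ with straight edges, and let it be isoradial: each face of $\Gamma_h$ (connected component of the complement of the drawing) is a polygon inscribed into a circle of diameter $h$ whose center lies inside the face. For an edge $e=\{u,v\}$ let $|e|=|u-v|$, and let $|e^*|$ be the length of the dual edge $e^*$, the segment joining the circumcenters of the two faces that share $e$. Assume that there are constants $c_p,c_d>0$ such that $c_ph\le|e|$ and $c_dh\le|e^*|$ for all $h>0$ and all $e\in E_h$. For $u\in V_h$ let $A_u$ be the area of the face dual to $u$, i.e. of the polygon whose corners are the circumcenters of the faces around $u$. Define, for functions $f$ on $V_h$, $$(\Delta_hf)(u)=\frac1{A_u}\sum_{v\sim u}\frac{|e^*_{uv}|}{|e_{uv}|}\,\bigl(f(v)-f(u)\bigr),$$ where $e_{uv}=\{u,v\}$, and the discrete heat kernel $$p^h_t(u,v)=\bigl(e^{\frac t2\Delta_h}\delta_u\bigr)(v)=\sum_{k=0}^\infty\frac1{k!}\,(\Delta_h^k\delta_u)(v)\Bigl(\frac t2\Bigr)^k,\qquad u,v\in V_h .$$ Let $d^c_h(u,v)$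 be the combinatorial graph distance (the least number of edges of a path in $\Gamma_h$ from $u$ to $v$). For each $h>0$ let $\pi_{V_h}:\mathbb C\to V_h$ map each point to a closest vertex (an arbitrary one if there are several), and write $p^h_t(x,y)=p^h_t(\pi_{V_h}(x),\pi_{V_h}(y))$ and $d^c_h(x,y)=d^c_h(\pi_{V_h}(x),\pi_{V_h}(y))$ for $x,y\in\mathbb C$. **Theorem 4.1 (Graph regime).** In this setting, $p^h$ solves, for every $h>0$ and $u\in V_h$, the heat equation $\partial_tp^h_t(u,\cdot)=\frac12\Delta_hp^h_t(u,\cdot)$ for $t>0$ with (continuously attained) initial value $p^h_0(u,\cdot)=\delta_u$, and it is bounded on bounded time intervals. Moreover, for all fixed $x,y\in\mathbb C$, $\beta>1$ and $t>0$, one has $p^h_{h^\beta t}(x,y)>0$ for every $h>0$, and $$\lim_{h\to0^+}\left[\frac{h}{\log h^{\beta-1}}\,\log p^h_{h^\beta t}(x,y)-h\,d^c_h(x,y)\right]=0 .$$ -/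

import Mathlib

open Set Filter Topology MeasureTheory

noncomputable section

/-- An infinite planar graph, embedded in `ℂ` with straight edges: the vertices are points of `ℂ`,
an edge `{u, v}` is drawn as the segment from `u` to `v`, the drawing has no crossings, and it is
locally finite (every bounded region meets only finitely many vertices and edges). -/
structure PlaneGraph where
  verts : Set ℂ
  graph : SimpleGraph verts
  infinite : verts.Infinite
  no_vertex_inside_edge : ∀ u v w : verts, graph.Adj u v →
    (w : ℂ) ∉ openSegment ℝ (u : ℂ) (v : ℂ)
  no_crossing : ∀ u v u' v' : verts, graph.Adj u v → graph.Adj u' v' → s(u, v) ≠ s(u', v') →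
    Disjoint (openSegment ℝ (u : ℂ) (v : ℂ)) (openSegment ℝ (u' : ℂ) (v' : ℂ))
  finite_verts : ∀ r : ℝ, (verts ∩ Metric.closedBall 0 r).Finite
  finite_edges : ∀ r : ℝ, {e : verts × verts | graph.Adj e.1 e.2 ∧
    (segment ℝ (e.1 : ℂ) (e.2 : ℂ) ∩ Metric.closedBall 0 r).Nonempty}.Finite

namespace PlaneGraph

variable (G : PlaneGraph)

/-- The subset of the plane that is covered by the vertices and edges. -/
def skeleton : Set ℂ :=
  G.verts ∪ {z | ∃ u v : G.verts, G.graph.Adj u v ∧ z ∈ segment ℝ (u : ℂ) (v : ℂ)}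

/-- The (open) faces: the connected components of the complement of the drawing. -/
def IsFace (F : Set ℂ) : Prop :=
  ∃ z ∈ G.skeletonᶜ, F = connectedComponentIn G.skeletonᶜ z

/-- The vertices of `G` on the boundary of a face. -/
def corners (F : Set ℂ) : Set ℂ := G.verts ∩ frontier F

/-- `c` is the center of a circle through all vertices of the face `F`. -/
def IsCircumcenter (F : Set ℂ) (c : ℂ) : Prop :=
  ∃ r : ℝ, ∀ v ∈ G.corners F, dist v c = r

/-- Every face is a polygon inscribed into a circle of diameter `h` (that is, the face is the open
polygon spanned by its corners, and these lie on the circle), and the center of the circle lies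
inside the face. -/
def IsIsoradial (h : ℝ) : Prop :=
  ∀ F : Set ℂ, G.IsFace F →
    F = interior (convexHull ℝ (G.corners F)) ∧
    ∃ c ∈ F, ∀ v ∈ G.corners F, dist v c = h / 2

/-- The Euclidean length `|e|` of the edge `e = {u, v}`. -/
def edgeLength (u v : G.verts) : ℝ := dist (u : ℂ) (v : ℂ)

/-- The end points of the dual edge of `e = {u, v}`: the circumcenters of the (two) faces that
have `e` on their boundary. -/
def dualEdgeEnds (u v : G.verts) : Set ℂ :=
  {c | ∃ F : Set ℂ, G.IsFace F ∧ segment ℝ (u : ℂ) (v : ℂ) ⊆ frontier F ∧ G.IsCircumcenter F c}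

/-- The length `|e*|` of the dual edge of `e = {u, v}`, the distance of its two end points. -/
def dualEdgeLength (u v : G.verts) : ℝ := Metric.diam (G.dualEdgeEnds u v)

/-- The face of the dual graph that corresponds to the vertex `u`: the open polygon whose corners
are the circumcenters of the faces around `u`. -/
def dualFace (u : G.verts) : Set ℂ :=
  interior (convexHull ℝ
    {c | ∃ F : Set ℂ, G.IsFace F ∧ (u : ℂ) ∈ frontier F ∧ G.IsCircumcenter F c})

/-- The area `A_u` of the face dual to `u`. -/
def dualArea (u : G.verts) : ℝ := (volume : Measure ℂ).real (G.dualFace u)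

/-- The edge weight `ω_{uv} = |e*| / |e|` of the edge `e = {u, v}`. -/
def weight (u v : G.verts) : ℝ := G.dualEdgeLength u v / G.edgeLength u v

/-- The geometric graph Laplacian
`(Δ f)(u) = (1 / A_u) ∑_{v ∼ u} ω_{uv} (f(v) - f(u))`. -/
def laplacian (f : G.verts → ℝ) (u : G.verts) : ℝ :=
  (1 / G.dualArea u) * ∑ᶠ v ∈ G.graph.neighborSet u, G.weight u v * (f v - f u)

/-- The function `δ_u`, which is `1` at `u` and `0` elsewhere. -/
def delta (u : G.verts) : G.verts → ℝ := Set.indicator {u} (fun _ => 1)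

/-- The discrete heat kernel `p_t(u, v) = (exp((t / 2) Δ) δ_u)(v)
= ∑_k (1 / k!) (Δ^k δ_u)(v) (t / 2)^k`. -/
def heatKernel (t : ℝ) (u v : G.verts) : ℝ :=
  ∑' k : ℕ, (1 / (k.factorial : ℝ)) * (G.laplacian^[k] (G.delta u)) v * (t / 2) ^ k

/-- `p` solves the heat equation `∂_t p_t(u, ·) = (1 / 2) Δ p_t(u, ·)` for `t > 0`, with
`p_0(u, ·) = δ_u` (continuously attained), and is bounded on bounded time intervals. -/
structure SolvesHeatEquation (p : ℝ → G.verts → G.verts → ℝ) : Prop where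
  initial : ∀ u v, p 0 u v = G.delta u v
  continuous_zero : ∀ u v, ContinuousWithinAt (fun s => p s u v) (Ici 0) 0
  equation : ∀ u v, ∀ t : ℝ, 0 < t →
    HasDerivAt (fun s => p s u v) ((1 / 2) * G.laplacian (p t u) v) t
  bounded : ∀ u, ∀ T : ℝ, ∃ C : ℝ, ∀ t ∈ Icc 0 T, ∀ v, |p t u v| ≤ C

/-- `π` sends every point of the plane to a closest vertex (with an arbitrary choice among the
closest ones if there are several). -/
def IsNearestVertexMap (π : ℂ → G.verts) : Prop :=
  ∀ z : ℂ, ∀ v : G.verts, dist z (π z : ℂ) ≤ dist z (v : ℂ)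

end PlaneGraph

end

/-!
The generator `Δ_h` has jump rates of exact order `h⁻²` along edges, and bounded degree. Writing it
as a bounded operator `L` with total rates at most `Λ = O(h⁻²)`, the kernel at time `2 s` from `u`
to `v` is trapped between two Poisson type expressions. On the one hand `(L ^ k δ_u)(v) = 0` for
`k < d(u, v)`, so that the exponential series is at most `(2 Λ s) ^ d / d! * exp (2 Λ s)`
(`abs_expSeries_le`). On the other hand `exp (Λ s) exp (s L) = exp (s (L + Λ))`, where `L + Λ` has
nonnegative entries and entries of order at least `h⁻²` along edges, so that keeping the term of
order `d` yields the lower bound `exp (-Λ s) (c s) ^ d / d!` (`le_expSeries_rateLaplacian`).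
For `s = h ^ β t / 2` and `d` of order `1 / h`, both sides are `(C h ^ (β - 1)) ^ d exp (O(1 / h))`.
Hence `log p = d log h ^ (β - 1) + O(1 / h)`, and the error disappears after division by
`log h ^ (β - 1) / h` (`tendsto_log_of_poisson_bounds`).

The geometric input is the following.

* Every edge `{u, v}` is a diagonal of a rhombus whose other two corners are the centers of the
  faces next to it. By convexity of the faces, the open rhombus lies in these two faces and the
  edge (`rhombus_subset`). A disk of radius comparable to `h` around the quarter point of the edge
  fits into it, so these disks meet no other edge, and comparing areas bounds degrees and the
  number of vertices in a disk (`PlaneGraph.IsBoundedIsoradial.card_edges_le`).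
* A vertex `u` lies in the convex hull of the circumcenters around it, since otherwise a small step
  away from the hull would leave all circumdisks (`PlaneGraph.vert_mem_convexHull_circumcenters`).
  The dual face of `u` thus contains the half of each rhombus at `u`, which bounds its area from
  below.
* The boundary of a face is connected, hence the corners of a face are connected to each other by
  its edges (`PlaneGraph.IsBoundedIsoradial.connectedWithin_corners`), and following the faces
  along a segment connects nearby vertices inside a disk that contains boundedly many vertices.
  So vertices at distance at most `3 h` have bounded graph distance. Cutting the segment from `x`
  to `y` into pieces of length `h` gives `d = O(1 / h)`; the converse bound holds because edges have
  length at most `h`.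
-/

/-! ### Exponential power series -/

theorem summable_expSeries_of_le {a : ℕ → ℝ} {C M : ℝ} (ha : ∀ k, |a k| ≤ C * M ^ k) (s : ℝ) :
    Summable fun k : ℕ => ‖(1 / (k.factorial : ℝ)) * a k * s ^ k‖ := by
  refine Summable.of_nonneg_of_le (fun k => norm_nonneg _) (fun k => ?_)
    ((Real.summable_pow_div_factorial (M * |s|)).mul_left C)
  rw [norm_mul, norm_mul, norm_pow, Real.norm_eq_abs, Real.norm_eq_abs, Real.norm_eq_abs,
    abs_of_nonneg (by positivity : (0 : ℝ) ≤ 1 / (k.factorial : ℝ))]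
  calc 1 / (k.factorial : ℝ) * |a k| * |s| ^ k
      ≤ 1 / (k.factorial : ℝ) * (C * M ^ k) * |s| ^ k := by gcongr; exact ha k
    _ = C * ((M * |s|) ^ k / (k.factorial : ℝ)) := by rw [mul_pow]; ring

theorem hasDerivAt_expSeries {a : ℕ → ℝ} {C M : ℝ} (ha : ∀ k, |a k| ≤ C * M ^ k) (s : ℝ) :
    HasDerivAt (fun s : ℝ => ∑' k : ℕ, (1 / (k.factorial : ℝ)) * a k * s ^ k)
      (∑' k : ℕ, (1 / (k.factorial : ℝ)) * a (k + 1) * s ^ k) s := by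
  have hfac : ∀ k : ℕ, 1 / ((k + 1).factorial : ℝ) * ((k + 1 : ℕ) : ℝ) = 1 / (k.factorial : ℝ) := by
    intro k
    rw [Nat.factorial_succ]
    push_cast
    field_simp
  set R : ℝ := |s| + 1 with hR
  have hR0 : 0 < R := by positivity
  have ha1 : ∀ k, |a (k + 1)| ≤ (C * M) * M ^ k := fun k => (ha (k + 1)).trans_eq (by ring)
  have hmain : HasDerivAt (fun s : ℝ => ∑' k : ℕ, (1 / (k.factorial : ℝ)) * a k * s ^ k)
      (∑' k : ℕ, (1 / (k.factorial : ℝ)) * a k * ((k : ℝ) * s ^ (k - 1))) s := by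
    refine hasDerivAt_tsum_of_isPreconnected (𝕜 := ℝ) (F := ℝ)
      (t := Metric.ball (0 : ℝ) R) (y₀ := s)
      (g := fun k s => (1 / (k.factorial : ℝ)) * a k * s ^ k)
      (g' := fun k s => (1 / (k.factorial : ℝ)) * a k * ((k : ℝ) * s ^ (k - 1)))
      (u := fun k : ℕ => ‖(1 / (k.factorial : ℝ)) * a k * ((k : ℝ) * R ^ (k - 1))‖)
      ?_ Metric.isOpen_ball (convex_ball (0 : ℝ) R).isPreconnected ?_ ?_ ?_ ?_ ?_
    · rw [← summable_nat_add_iff 1]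
      refine (summable_expSeries_of_le ha1 R).congr fun k => ?_
      rw [← hfac k, Nat.add_sub_cancel]
      ring_nf
    · intro k y _
      simpa using (hasDerivAt_pow k y).const_mul ((1 / (k.factorial : ℝ)) * a k)
    · intro k y hy
      rw [Metric.mem_ball, dist_zero_right] at hy
      simp only [norm_mul, norm_pow]
      gcongr
      exact hy.le.trans (le_abs_self R)
    · simp [hR]
    · exact (summable_expSeries_of_le ha s).of_norm
    · simp [hR]
  convert hmain using 1
  have hs : Summable fun k : ℕ => (1 / (k.factorial : ℝ)) * a k * ((k : ℝ) * s ^ (k - 1)) := by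
    rw [← summable_nat_add_iff 1]
    refine (summable_expSeries_of_le ha1 s).of_norm.congr fun k => ?_
    rw [← hfac k, Nat.add_sub_cancel]
    ring
  rw [hs.tsum_eq_zero_add]
  simp only [Nat.cast_zero, zero_mul, mul_zero, zero_add, Nat.add_sub_cancel]
  refine tsum_congr fun k => ?_
  rw [← hfac k]
  ring

/-- If the first `d` coefficients vanish, the exponential series is dominated by its leading
term. -/
theorem abs_expSeries_le {a : ℕ → ℝ} {M : ℝ} (ha : ∀ k, |a k| ≤ M ^ k) {d : ℕ}
    (h0 : ∀ k < d, a k = 0) {s : ℝ} (hs : 0 ≤ s) :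
    |∑' k : ℕ, (1 / (k.factorial : ℝ)) * a k * s ^ k|
      ≤ (M * s) ^ d / (d.factorial : ℝ) * Real.exp (M * s) := by
  have hsum := summable_expSeries_of_le (C := 1) (M := M) (a := a) (by simpa using ha) s
  rw [← hsum.of_norm.sum_add_tsum_nat_add d, Finset.sum_eq_zero, zero_add]
  · have hexp : HasSum (fun k : ℕ => (M * s) ^ k / (k.factorial : ℝ)) (Real.exp (M * s)) := by
      rw [Real.exp_eq_exp_ℝ]
      exact NormedSpace.expSeries_div_hasSum_exp (M * s)
    rw [← Real.norm_eq_abs]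
    refine tsum_of_norm_bounded (hexp.mul_left ((M * s) ^ d / (d.factorial : ℝ))) fun k => ?_
    have hf : (d.factorial : ℝ) * (k.factorial : ℝ) ≤ ((k + d).factorial : ℝ) := by
      rw [add_comm k d]
      exact_mod_cast Nat.le_of_dvd (Nat.factorial_pos _)
        (Nat.factorial_mul_factorial_dvd_factorial_add d k)
    rw [norm_mul, norm_mul, norm_pow, Real.norm_eq_abs, Real.norm_eq_abs, Real.norm_eq_abs,
      abs_of_nonneg hs, abs_of_nonneg (by positivity : (0 : ℝ) ≤ 1 / ((k + d).factorial : ℝ))]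
    calc 1 / ((k + d).factorial : ℝ) * |a (k + d)| * s ^ (k + d)
        ≤ 1 / ((d.factorial : ℝ) * (k.factorial : ℝ)) * M ^ (k + d) * s ^ (k + d) := by
          gcongr
          exact ha _
      _ = (M * s) ^ d / (d.factorial : ℝ) * ((M * s) ^ k / (k.factorial : ℝ)) := by
          rw [pow_add, pow_add, mul_pow, mul_pow]
          field_simp
  · intro k hk
    rw [h0 k (Finset.mem_range.1 hk)]
    simp

/-! ### Generators with bounded jump rates -/

section Rates

variable {V : Type*}

/-- The generator `f ↦ ∑_{w ∈ N v} q(v, w) (f(w) - f(v))` of the continuous time random walk that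
jumps from `v` to `w ∈ N v` at rate `q(v, w)`. -/
def rateLaplacian (N : V → Finset V) (q : V → V → ℝ) : Module.End ℝ (V → ℝ) where
  toFun f v := ∑ w ∈ N v, q v w * (f w - f v)
  map_add' f g := by
    funext v
    simp only [Pi.add_apply, ← Finset.sum_add_distrib]
    exact Finset.sum_congr rfl fun w _ => by ring
  map_smul' c f := by
    funext v
    simp only [Pi.smul_apply, smul_eq_mul, RingHom.id_apply, Finset.mul_sum]
    exact Finset.sum_congr rfl fun w _ => by ring

theorem rateLaplacian_apply (N : V → Finset V) (q : V → V → ℝ) (f : V → ℝ) (v : V) :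
    rateLaplacian N q f v = ∑ w ∈ N v, q v w * (f w - f v) := rfl

variable {N : V → Finset V} {q : V → V → ℝ} {Λ : ℝ}

theorem abs_rateLaplacian_le (hq : ∀ v, ∀ w ∈ N v, 0 ≤ q v w) (hΛ : ∀ v, ∑ w ∈ N v, q v w ≤ Λ)
    {f : V → ℝ} {C : ℝ} (hf : ∀ v, |f v| ≤ C) (v : V) :
    |rateLaplacian N q f v| ≤ 2 * Λ * C := by
  have hC : 0 ≤ C := (abs_nonneg _).trans (hf v)
  calc |rateLaplacian N q f v| ≤ ∑ w ∈ N v, |q v w * (f w - f v)| := Finset.abs_sum_le_sum_abs _ _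
    _ ≤ ∑ w ∈ N v, q v w * (2 * C) := by
        refine Finset.sum_le_sum fun w hw => ?_
        rw [abs_mul, abs_of_nonneg (hq v w hw)]
        refine mul_le_mul_of_nonneg_left ?_ (hq v w hw)
        have := abs_sub (f w) (f v)
        linarith [hf w, hf v]
    _ = (∑ w ∈ N v, q v w) * (2 * C) := by rw [Finset.sum_mul]
    _ ≤ Λ * (2 * C) := by gcongr; exact hΛ v
    _ = 2 * Λ * C := by ring

theorem abs_rateLaplacian_pow_le (hq : ∀ v, ∀ w ∈ N v, 0 ≤ q v w)
    (hΛ : ∀ v, ∑ w ∈ N v, q v w ≤ Λ) {f : V → ℝ} (hf : ∀ v, |f v| ≤ 1) (k : ℕ) (v : V) :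
    |(rateLaplacian N q ^ k) f v| ≤ (2 * Λ) ^ k := by
  induction k generalizing v with
  | zero => simpa using hf v
  | succ k ih =>
    rw [pow_succ', pow_succ', Module.End.mul_apply]
    exact abs_rateLaplacian_le hq hΛ ih v

/-- The propagation speed is finite: `k` applications of the generator move mass by at most `k`
edges. -/
theorem exists_walk_of_rateLaplacian_pow_ne_zero {G : SimpleGraph V}
    (hN : ∀ v, ∀ w ∈ N v, G.Adj v w) {f : V → ℝ} {u : V} (hf : ∀ v, f v ≠ 0 → v = u) (k : ℕ)
    (v : V) (h : (rateLaplacian N q ^ k) f v ≠ 0) : ∃ p : G.Walk v u, p.length ≤ k := by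
  induction k generalizing v with
  | zero =>
    obtain rfl := hf v h
    exact ⟨.nil, le_rfl⟩
  | succ k ih =>
    rw [pow_succ', Module.End.mul_apply, rateLaplacian_apply] at h
    obtain ⟨w, hw, hne⟩ := Finset.exists_ne_zero_of_sum_ne_zero h
    by_cases hv : (rateLaplacian N q ^ k) f v = 0
    · obtain ⟨p, hp⟩ := ih w fun h0 => hne (by rw [hv, h0]; simp)
      exact ⟨.cons (hN v w hw) p, by simpa using hp⟩
    · obtain ⟨p, hp⟩ := ih v hv
      exact ⟨p, hp.trans k.le_succ⟩

theorem rateLaplacian_add_apply (f : V → ℝ) (v : V) :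
    (rateLaplacian N q + algebraMap ℝ (Module.End ℝ (V → ℝ)) Λ) f v
      = ∑ w ∈ N v, q v w * f w + (Λ - ∑ w ∈ N v, q v w) * f v := by
  simp only [LinearMap.add_apply, Pi.add_apply, rateLaplacian_apply, Module.algebraMap_end_apply,
    Pi.smul_apply, smul_eq_mul, mul_sub, Finset.sum_sub_distrib, ← Finset.sum_mul]
  ring

theorem rateLaplacian_add_pow_nonneg (hq : ∀ v, ∀ w ∈ N v, 0 ≤ q v w)
    (hΛ : ∀ v, ∑ w ∈ N v, q v w ≤ Λ) {f : V → ℝ} (hf : ∀ v, 0 ≤ f v) (k : ℕ) (v : V) :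
    0 ≤ ((rateLaplacian N q + algebraMap ℝ (Module.End ℝ (V → ℝ)) Λ) ^ k) f v := by
  induction k generalizing v with
  | zero => simpa using hf v
  | succ k ih =>
    rw [pow_succ', Module.End.mul_apply, rateLaplacian_add_apply]
    exact add_nonneg (Finset.sum_nonneg fun w hw => mul_nonneg (hq v w hw) (ih w))
      (mul_nonneg (sub_nonneg.2 (hΛ v)) (ih v))

theorem pow_length_le_rateLaplacian_add_pow {G : SimpleGraph V}
    (hN : ∀ v w, G.Adj v w → w ∈ N v) {c : ℝ} (hc : 0 ≤ c) (hcq : ∀ v, ∀ w ∈ N v, c ≤ q v w)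
    (hΛ : ∀ v, ∑ w ∈ N v, q v w ≤ Λ) {f : V → ℝ} (hf : ∀ v, 0 ≤ f v) {u v : V} (hu : 1 ≤ f u)
    (p : G.Walk v u) :
    c ^ p.length
      ≤ ((rateLaplacian N q + algebraMap ℝ (Module.End ℝ (V → ℝ)) Λ) ^ p.length) f v := by
  have hq : ∀ v, ∀ w ∈ N v, 0 ≤ q v w := fun v w hw => hc.trans (hcq v w hw)
  induction p with
  | nil => simpa using hu
  | @cons v w u hvw p ih =>
    rw [SimpleGraph.Walk.length_cons, pow_succ', pow_succ', Module.End.mul_apply,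
      rateLaplacian_add_apply]
    have hnn := rateLaplacian_add_pow_nonneg hq hΛ hf p.length
    have hw := hN v w hvw
    calc c * c ^ p.length ≤ q v w * _ :=
          mul_le_mul (hcq v w hw) (ih hu) (by positivity) (hq v w hw)
      _ ≤ _ := Finset.single_le_sum (f := fun w => q v w * _)
          (fun w hw => mul_nonneg (hq v w hw) (hnn w)) hw
      _ ≤ _ := le_add_of_nonneg_right (mul_nonneg (sub_nonneg.2 (hΛ v)) (hnn v))

/-- Uniformization: `exp(Λ s) exp(s L) = exp(s (L + Λ))`. -/
theorem exp_mul_expSeries_rateLaplacian (hq : ∀ v, ∀ w ∈ N v, 0 ≤ q v w)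
    (hΛ : ∀ v, ∑ w ∈ N v, q v w ≤ Λ) {f : V → ℝ} (hf : ∀ v, |f v| ≤ 1) (s : ℝ) (v : V) :
    HasSum (fun n : ℕ => (1 / (n.factorial : ℝ)) *
        ((rateLaplacian N q + algebraMap ℝ (Module.End ℝ (V → ℝ)) Λ) ^ n) f v * s ^ n)
      (Real.exp (Λ * s) *
        ∑' k : ℕ, (1 / (k.factorial : ℝ)) * (rateLaplacian N q ^ k) f v * s ^ k) := by
  have h1 : Summable fun k : ℕ => ‖(Λ * s) ^ k / (k.factorial : ℝ)‖ :=
    (Real.summable_pow_div_factorial (Λ * s)).norm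
  have h2 := summable_expSeries_of_le (C := 1) (M := 2 * Λ)
    (a := fun k => (rateLaplacian N q ^ k) f v)
    (by simpa using fun k => abs_rateLaplacian_pow_le hq hΛ hf k v) s
  have hexp : Real.exp (Λ * s) = ∑' k : ℕ, (Λ * s) ^ k / (k.factorial : ℝ) := by
    rw [Real.exp_eq_exp_ℝ]
    exact (NormedSpace.expSeries_div_hasSum_exp (Λ * s)).tsum_eq.symm
  rw [hexp, tsum_mul_tsum_eq_tsum_sum_antidiagonal_of_summable_norm h1 h2]
  have hterm : ∀ n : ℕ, ∑ kl ∈ Finset.HasAntidiagonal.antidiagonal n,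
      (Λ * s) ^ kl.1 / (kl.1.factorial : ℝ) *
        ((1 / (kl.2.factorial : ℝ)) * (rateLaplacian N q ^ kl.2) f v * s ^ kl.2)
      = (1 / (n.factorial : ℝ)) *
        ((rateLaplacian N q + algebraMap ℝ (Module.End ℝ (V → ℝ)) Λ) ^ n) f v * s ^ n := by
    intro n
    have hcomm : Commute (algebraMap ℝ (Module.End ℝ (V → ℝ)) Λ) (rateLaplacian N q) :=
      Algebra.commutes _ _
    rw [add_comm (rateLaplacian N q), hcomm.add_pow', LinearMap.sum_apply, Finset.sum_apply,
      Finset.mul_sum, Finset.sum_mul]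
    refine Finset.sum_congr rfl fun kl hkl => ?_
    obtain rfl := Finset.HasAntidiagonal.mem_antidiagonal.1 hkl
    rw [← map_pow, LinearMap.smul_apply, Module.End.mul_apply, Module.algebraMap_end_apply,
      Pi.smul_apply, Pi.smul_apply, nsmul_eq_mul, smul_eq_mul, pow_add, mul_pow]
    have hch := Nat.add_choose_mul_factorial_mul_factorial kl.1 kl.2
    rw [← Nat.choose_symm_add] at hch
    rw [← hch]
    have hne : ((kl.1 + kl.2).choose kl.1 : ℝ) ≠ 0 :=
      Nat.cast_ne_zero.2 (Nat.choose_pos (Nat.le_add_right _ _)).ne'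
    push_cast
    field_simp
  simp_rw [hterm]
  have h3 := summable_norm_sum_mul_antidiagonal_of_summable_norm h1 h2
  simp_rw [hterm] at h3
  exact h3.of_norm.hasSum

theorem abs_expSeries_rateLaplacian_le {G : SimpleGraph V} (hN : ∀ v, ∀ w ∈ N v, G.Adj v w)
    (hq : ∀ v, ∀ w ∈ N v, 0 ≤ q v w) (hΛ : ∀ v, ∑ w ∈ N v, q v w ≤ Λ) {f : V → ℝ} {u : V}
    (hf : ∀ v, |f v| ≤ 1) (hfu : ∀ v, f v ≠ 0 → v = u) {s : ℝ} (hs : 0 ≤ s) (v : V) :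
    |∑' k : ℕ, (1 / (k.factorial : ℝ)) * (rateLaplacian N q ^ k) f v * s ^ k|
      ≤ (2 * Λ * s) ^ G.dist u v / ((G.dist u v).factorial : ℝ) * Real.exp (2 * Λ * s) := by
  refine abs_expSeries_le (fun k => abs_rateLaplacian_pow_le hq hΛ hf k v) (fun k hk => ?_) hs
  by_contra hne
  obtain ⟨p, hp⟩ := exists_walk_of_rateLaplacian_pow_ne_zero hN hfu k v hne
  have := SimpleGraph.dist_le p
  rw [SimpleGraph.dist_comm] at this
  omega

theorem le_expSeries_rateLaplacian {G : SimpleGraph V} (hN : ∀ v w, G.Adj v w → w ∈ N v)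
    {c : ℝ} (hc : 0 ≤ c) (hcq : ∀ v, ∀ w ∈ N v, c ≤ q v w) (hΛ : ∀ v, ∑ w ∈ N v, q v w ≤ Λ)
    {f : V → ℝ} {u v : V} (hf : ∀ v, |f v| ≤ 1) (hf0 : ∀ v, 0 ≤ f v) (hfu : 1 ≤ f u)
    (h : G.Reachable u v) {s : ℝ} (hs : 0 ≤ s) :
    Real.exp (-(Λ * s)) * ((c * s) ^ G.dist u v / ((G.dist u v).factorial : ℝ))
      ≤ ∑' k : ℕ, (1 / (k.factorial : ℝ)) * (rateLaplacian N q ^ k) f v * s ^ k := by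
  have hq : ∀ v, ∀ w ∈ N v, 0 ≤ q v w := fun v w hw => hc.trans (hcq v w hw)
  have hsum := exp_mul_expSeries_rateLaplacian hq hΛ hf s v
  obtain ⟨p, hp⟩ := h.symm.exists_walk_length_eq_dist
  rw [SimpleGraph.dist_comm] at hp
  have hle := le_hasSum hsum (G.dist u v) fun n _ =>
    mul_nonneg (mul_nonneg (by positivity) (rateLaplacian_add_pow_nonneg hq hΛ hf0 n v))
      (pow_nonneg hs n)
  have hpow := pow_length_le_rateLaplacian_add_pow hN hc hcq hΛ hf0 hfu p
  rw [hp] at hpow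
  rw [Real.exp_neg, inv_mul_le_iff₀ (Real.exp_pos _)]
  refine le_trans ?_ hle
  rw [mul_pow]
  calc c ^ G.dist u v * s ^ G.dist u v / ((G.dist u v).factorial : ℝ)
      = 1 / ((G.dist u v).factorial : ℝ) * c ^ G.dist u v * s ^ G.dist u v := by ring
    _ ≤ _ := by gcongr

end Rates

namespace PlaneGraph

/-! ### The heat kernel as an exponential series -/

variable {G : PlaneGraph}

theorem delta_self (u : G.verts) : G.delta u u = 1 := by simp [delta]

theorem delta_nonneg (u v : G.verts) : 0 ≤ G.delta u v :=
  Set.indicator_nonneg (fun _ _ => zero_le_one) _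

theorem delta_le_one (u v : G.verts) : G.delta u v ≤ 1 :=
  Set.indicator_le_self' (fun _ _ => zero_le_one) _

theorem abs_delta_le_one (u v : G.verts) : |G.delta u v| ≤ 1 := by
  rw [abs_of_nonneg (delta_nonneg u v)]
  exact delta_le_one u v

theorem eq_of_delta_ne_zero {u v : G.verts} (h : G.delta u v ≠ 0) : v = u := by
  by_contra hne
  exact h (Set.indicator_of_notMem (s := {u}) hne _)

/-- The rate at which the random walk generated by the Laplacian jumps along an edge. -/
noncomputable def rate (G : PlaneGraph) (u v : G.verts) : ℝ := G.weight u v / G.dualArea u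

theorem laplacian_eq_rateLaplacian {N : G.verts → Finset G.verts}
    (hN : ∀ v w, w ∈ N v ↔ G.graph.Adj v w) :
    G.laplacian = rateLaplacian N G.rate := by
  funext f u
  have hset : G.graph.neighborSet u = (N u : Set G.verts) := by
    ext w
    simp [hN]
  rw [laplacian, hset, finsum_mem_coe_finset, rateLaplacian_apply, Finset.mul_sum]
  refine Finset.sum_congr rfl fun w _ => ?_
  rw [rate]
  ring

theorem heatKernel_eq {N : G.verts → Finset G.verts} (hN : ∀ v w, w ∈ N v ↔ G.graph.Adj v w)
    (t : ℝ) (u v : G.verts) :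
    G.heatKernel t u v = ∑' k : ℕ, (1 / (k.factorial : ℝ)) *
      (rateLaplacian N G.rate ^ k) (G.delta u) v * (t / 2) ^ k := by
  simp only [heatKernel, laplacian_eq_rateLaplacian hN, Module.End.pow_apply]

theorem solvesHeatEquation_heatKernel {N : G.verts → Finset G.verts}
    (hN : ∀ v w, w ∈ N v ↔ G.graph.Adj v w) {Λ : ℝ} (hq : ∀ v, ∀ w ∈ N v, 0 ≤ G.rate v w)
    (hΛ : ∀ v, ∑ w ∈ N v, G.rate v w ≤ Λ) : G.SolvesHeatEquation G.heatKernel := by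
  have hbd : ∀ u v k, |(rateLaplacian N G.rate ^ k) (G.delta u) v| ≤ 1 * (2 * Λ) ^ k := by
    intro u v k
    rw [one_mul]
    exact abs_rateLaplacian_pow_le hq hΛ (abs_delta_le_one u) k v
  have hderiv : ∀ u v t, HasDerivAt (fun s => G.heatKernel s u v)
      ((1 / 2) * G.laplacian (G.heatKernel t u) v) t := by
    intro u v t
    simp only [heatKernel_eq hN]
    have h := (hasDerivAt_expSeries (hbd u v) (t / 2)).comp t ((hasDerivAt_id t).div_const 2)
    refine HasDerivAt.congr_deriv (f := fun s => ∑' k : ℕ, (1 / (k.factorial : ℝ)) *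
      (rateLaplacian N G.rate ^ k) (G.delta u) v * (s / 2) ^ k) h ?_
    rw [laplacian_eq_rateLaplacian hN, rateLaplacian_apply, mul_comm]
    congr 1
    have hs := fun w => (summable_expSeries_of_le (hbd u w) (t / 2)).of_norm
    have hterm : ∀ w ∈ N v, G.rate v w * (G.heatKernel t u w - G.heatKernel t u v)
        = ∑' k : ℕ, G.rate v w * ((1 / (k.factorial : ℝ)) *
            (rateLaplacian N G.rate ^ k) (G.delta u) w * (t / 2) ^ k
          - (1 / (k.factorial : ℝ)) *
            (rateLaplacian N G.rate ^ k) (G.delta u) v * (t / 2) ^ k) := by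
      intro w _
      rw [tsum_mul_left, (hs w).tsum_sub (hs v), heatKernel_eq hN, heatKernel_eq hN]
    rw [Finset.sum_congr rfl hterm,
      ← Summable.tsum_finsetSum fun w _ => ((hs w).sub (hs v)).mul_left _]
    refine tsum_congr fun k => ?_
    rw [pow_succ', Module.End.mul_apply, rateLaplacian_apply, Finset.mul_sum, Finset.sum_mul]
    exact Finset.sum_congr rfl fun w _ => by ring
  refine ⟨fun u v => ?_, fun u v => (hderiv u v 0).continuousAt.continuousWithinAt,
    fun u v t _ => hderiv u v t, fun u T => ?_⟩
  · rw [heatKernel_eq hN, tsum_eq_single 0]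
    · simp
    · intro k hk
      simp [hk]
  · refine ⟨Real.exp (2 * Λ * (T / 2)), fun t ht v => ?_⟩
    have hΛ0 : 0 ≤ Λ := (Finset.sum_nonneg (hq v)).trans (hΛ v)
    rw [heatKernel_eq hN]
    have h := abs_expSeries_le (d := 0) (fun k => by simpa using hbd u v k) (by simp)
      (div_nonneg ht.1 zero_le_two)
    refine h.trans ?_
    simp only [pow_zero, Nat.factorial_zero, Nat.cast_one, div_one, one_mul]
    have := ht.2
    gcongr

end PlaneGraph

/-! ### Asymptotics of kernels with Poisson type bounds -/

theorem pow_div_factorial_le {x y : ℝ} (hx : 0 ≤ x) (hy : 0 < y) {d : ℕ}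
    (hd : d = 0 ∨ y ≤ d) : x ^ d / (d.factorial : ℝ) ≤ (x * Real.exp 1 / y) ^ d := by
  rcases hd with rfl | hd
  · simp
  have h := Real.pow_div_factorial_le_exp (x := (d : ℝ)) (by positivity) d
  rw [div_le_iff₀ (by positivity), ← mul_one (d : ℝ), Real.exp_nat_mul, mul_one] at h
  rw [div_pow, mul_pow, div_le_div_iff₀ (by positivity) (by positivity)]
  calc x ^ d * y ^ d ≤ x ^ d * (d : ℝ) ^ d := by gcongr
    _ ≤ x ^ d * (Real.exp 1 ^ d * d.factorial) := by gcongr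
    _ = _ := by ring

theorem le_pow_div_factorial {x y : ℝ} (hx : 0 ≤ x) {d : ℕ} (hd : (d : ℝ) ≤ y) :
    (x / y) ^ d ≤ x ^ d / (d.factorial : ℝ) := by
  rw [div_pow]
  have h : (d.factorial : ℝ) ≤ (d : ℝ) ^ d := by exact_mod_cast Nat.factorial_le_pow d
  gcongr
  exact h.trans (by gcongr)

/-- Two-sided bounds of the form `exp(± A / h) (c h^(β - 1)) ^ d` with `d = O(1 / h)` determine the
logarithm up to `O(1 / h)`, which is negligible against `log h^(β - 1) / h`. -/
theorem tendsto_log_of_poisson_bounds {β A K c C : ℝ} (hβ : 1 < β) (hc : 0 < c) (hC : 0 < C)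
    {p : ℝ → ℝ} {d : ℝ → ℕ} (hd : ∀ᶠ h in 𝓝[>] (0 : ℝ), (d h : ℝ) ≤ K / h)
    (hl : ∀ᶠ h in 𝓝[>] (0 : ℝ), Real.exp (-(A / h)) * (c * h ^ (β - 1)) ^ d h ≤ p h)
    (hu : ∀ᶠ h in 𝓝[>] (0 : ℝ), p h ≤ Real.exp (A / h) * (C * h ^ (β - 1)) ^ d h) :
    Tendsto (fun h : ℝ => h / Real.log (h ^ (β - 1)) * Real.log (p h) - h * (d h : ℝ))
      (𝓝[>] 0) (𝓝 0) := by
  have hlog : Tendsto (fun h : ℝ => (β - 1) * Real.log h) (𝓝[>] 0) atBot :=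
    Real.tendsto_log_nhdsGT_zero.const_mul_atBot (by linarith)
  have hlim : Tendsto (fun h : ℝ =>
      (A + K * (|Real.log c| + |Real.log C|)) / -((β - 1) * Real.log h)) (𝓝[>] 0) (𝓝 0) :=
    (tendsto_neg_atBot_atTop.comp hlog).const_div_atTop _
  refine squeeze_zero_norm' ?_ hlim
  filter_upwards [hd, hl, hu, self_mem_nhdsWithin, hlog.eventually_lt_atBot 0]
    with h hd hl hu (h0 : 0 < h) hneg
  have hpow : 0 < h ^ (β - 1) := Real.rpow_pos_of_pos h0 _
  have hp : 0 < p h := lt_of_lt_of_le (by positivity) hl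
  have hl' := Real.log_le_log (by positivity) hl
  have hu' := Real.log_le_log hp hu
  rw [Real.log_mul (by positivity) (by positivity), Real.log_exp, Real.log_pow,
    Real.log_mul (by positivity) (by positivity)] at hl' hu'
  rw [Real.log_rpow h0] at hl' hu' ⊢
  set l := (β - 1) * Real.log h
  have hKd : h * (d h : ℝ) ≤ K := by rwa [le_div_iff₀ h0, mul_comm] at hd
  have hA : h * (A / h) = A := by field_simp
  have e : h / l * Real.log (p h) - h * (d h : ℝ) = h * (Real.log (p h) - d h * l) / l := by
    have := hneg.ne
    field_simp
  rw [e, norm_div, Real.norm_eq_abs l, abs_of_neg hneg]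
  refine div_le_div_of_nonneg_right ?_ (by linarith)
  have hb : ∀ z : ℝ, h * ((d h : ℝ) * |z|) ≤ K * |z| := fun z => by
    rw [← mul_assoc]; gcongr
  have h1 : -(A / h) - d h * |Real.log c| ≤ Real.log (p h) - d h * l := by
    have := mul_le_mul_of_nonneg_left (neg_abs_le (Real.log c)) (Nat.cast_nonneg (α := ℝ) (d h))
    linarith
  have h2 : Real.log (p h) - d h * l ≤ A / h + d h * |Real.log C| := by
    have := mul_le_mul_of_nonneg_left (le_abs_self (Real.log C)) (Nat.cast_nonneg (α := ℝ) (d h))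
    linarith
  have h1' := mul_le_mul_of_nonneg_left h1 h0.le
  have h2' := mul_le_mul_of_nonneg_left h2 h0.le
  have hK : 0 ≤ K := le_trans (by positivity) hKd
  have n1 := mul_nonneg hK (abs_nonneg (Real.log c))
  have n2 := mul_nonneg hK (abs_nonneg (Real.log C))
  rw [Real.norm_eq_abs, abs_le]
  constructor <;> nlinarith [hb (Real.log c), hb (Real.log C)]

namespace PlaneGraph

/-! ### Faces of an isoradial graph -/

section Faces

variable {G : PlaneGraph} {h : ℝ} {F F' : Set ℂ}

theorem vert_mem_skeleton (u : G.verts) : (u : ℂ) ∈ G.skeleton := Or.inl u.2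

theorem segment_subset_skeleton {u v : G.verts} (huv : G.graph.Adj u v) :
    segment ℝ (u : ℂ) v ⊆ G.skeleton := fun _ hz => Or.inr ⟨u, v, huv, hz⟩

theorem IsFace.nonempty (hF : G.IsFace F) : F.Nonempty := by
  obtain ⟨z, hz, rfl⟩ := hF
  exact ⟨z, mem_connectedComponentIn hz⟩

theorem IsFace.notMem_skeleton (hF : G.IsFace F) {z : ℂ} (hz : z ∈ F) : z ∉ G.skeleton := by
  obtain ⟨w, hw, rfl⟩ := hF
  exact connectedComponentIn_subset _ _ hz

theorem exists_isFace_mem {z : ℂ} (hz : z ∉ G.skeleton) : ∃ F, G.IsFace F ∧ z ∈ F :=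
  ⟨_, ⟨z, hz, rfl⟩, mem_connectedComponentIn hz⟩

theorem IsFace.eq_of_mem (hF : G.IsFace F) (hF' : G.IsFace F') {z : ℂ} (hz : z ∈ F)
    (hz' : z ∈ F') : F = F' := by
  obtain ⟨w, hw, rfl⟩ := hF
  obtain ⟨w', hw', rfl⟩ := hF'
  rw [connectedComponentIn_eq hz, connectedComponentIn_eq hz']

theorem IsFace.isOpen (hiso : G.IsIsoradial h) (hF : G.IsFace F) : IsOpen F := by
  rw [(hiso F hF).1]
  exact isOpen_interior

theorem IsFace.convex (hiso : G.IsIsoradial h) (hF : G.IsFace F) : Convex ℝ F := by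
  rw [(hiso F hF).1]
  exact (convex_convexHull ℝ _).interior

theorem IsFace.subset_convexHull (hiso : G.IsIsoradial h) (hF : G.IsFace F) :
    F ⊆ convexHull ℝ (G.corners F) :=
  (hiso F hF).1.subset.trans interior_subset

theorem IsFace.mem_frontier (hiso : G.IsIsoradial h) (hF : G.IsFace F) {z : ℂ}
    (hz : z ∈ closure F) (hs : z ∈ G.skeleton) : z ∈ frontier F := by
  rw [(hF.isOpen hiso).frontier_eq]
  exact ⟨hz, fun h => hF.notMem_skeleton h hs⟩

theorem IsFace.frontier_subset_skeleton (hiso : G.IsIsoradial h) (hF : G.IsFace F) :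
    frontier F ⊆ G.skeleton := by
  intro z hz
  by_contra hs
  obtain ⟨F', hF', hz'⟩ := exists_isFace_mem hs
  obtain ⟨w, hw', hw⟩ := mem_closure_iff.1 (frontier_subset_closure hz) F' (hF'.isOpen hiso) hz'
  rw [hF'.eq_of_mem hF hw' hw] at hz'
  rw [(hF.isOpen hiso).frontier_eq] at hz
  exact hz.2 hz'

theorem IsFace.closure_subset_closedBall (hiso : G.IsIsoradial h) (hF : G.IsFace F) {c : ℂ}
    {r : ℝ} (hc : ∀ v ∈ G.corners F, dist v c ≤ r) : closure F ⊆ Metric.closedBall c r :=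
  closure_minimal ((hF.subset_convexHull hiso).trans
    (convexHull_min (fun v hv => hc v hv) (convex_closedBall _ _))) Metric.isClosed_closedBall

theorem IsFace.corners_nonempty (hiso : G.IsIsoradial h) (hF : G.IsFace F) :
    (G.corners F).Nonempty := by
  rw [← convexHull_nonempty_iff (𝕜 := ℝ)]
  exact hF.nonempty.mono (hF.subset_convexHull hiso)

theorem IsFace.dist_le (hiso : G.IsIsoradial h) (hF : G.IsFace F) {z w : ℂ} (hz : z ∈ closure F)
    (hw : w ∈ closure F) : dist z w ≤ h := by
  obtain ⟨-, c, -, hc⟩ := hiso F hF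
  have hsub := hF.closure_subset_closedBall hiso fun v hv => (hc v hv).le
  linarith [dist_triangle_right z w c, Metric.mem_closedBall.1 (hsub hz),
    Metric.mem_closedBall.1 (hsub hw)]

theorem IsFace.corners_subset_closure : G.corners F ⊆ closure F :=
  fun _ hv => frontier_subset_closure hv.2

theorem finite_verts_inter_closedBall (p : ℂ) (R : ℝ) :
    (G.verts ∩ Metric.closedBall p R).Finite := by
  refine (G.finite_verts (R + dist p 0)).subset (inter_subset_inter_right _ ?_)
  exact Metric.closedBall_subset_closedBall' le_rfl

theorem IsFace.corners_finite (hiso : G.IsIsoradial h) (hF : G.IsFace F) :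
    (G.corners F).Finite := by
  obtain ⟨z, hz⟩ := hF.nonempty
  exact (finite_verts_inter_closedBall z h).subset fun v hv =>
    ⟨hv.1, hF.dist_le hiso (IsFace.corners_subset_closure hv) (subset_closure hz)⟩

/-- A face is determined by its corners, so only finitely many faces have all their corners in a
given bounded region. -/
theorem finite_faces_corners_subset (hiso : G.IsIsoradial h) (p : ℂ) (R : ℝ) :
    {F | G.IsFace F ∧ G.corners F ⊆ Metric.closedBall p R}.Finite := by
  refine ((finite_verts_inter_closedBall (G := G) p R).finite_subsets.image
    fun s => interior (convexHull ℝ s)).subset ?_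
  rintro F ⟨hF, hsub⟩
  exact ⟨G.corners F, subset_inter inter_subset_left hsub, (hiso F hF).1.symm⟩

instance : Countable G.verts := by
  have h : G.verts ⊆ ⋃ n : ℕ, G.verts ∩ Metric.closedBall 0 (n : ℝ) := fun z hz => by
    obtain ⟨n, hn⟩ := exists_nat_ge (dist z 0)
    exact mem_iUnion.2 ⟨n, hz, hn⟩
  exact ((countable_iUnion fun n : ℕ => (G.finite_verts n).countable).mono h).to_subtype

theorem volume_segment (a b : ℂ) : volume (segment ℝ a b) = 0 := by
  refine measure_mono_null (t := (affineSpan ℝ {a, b} : Set ℂ)) ?_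
    (Measure.addHaar_affineSubspace _ _ ?_)
  · rw [← convexHull_pair]
    exact convexHull_subset_affineSpan _
  · intro htop
    have h1 := (collinear_pair ℝ a b).finrank_le_one
    rw [← direction_affineSpan, htop, AffineSubspace.direction_top, finrank_top,
      Complex.finrank_real_complex] at h1
    omega

/-- The drawing is a countable union of segments, hence a null set. -/
theorem dense_compl_skeleton : Dense G.skeletonᶜ := by
  rw [← interior_eq_empty_iff_dense_compl]
  refine Measure.interior_eq_empty_of_null (μ := volume) ?_
  refine measure_mono_null (t := ⋃ e : G.verts × G.verts, segment ℝ (e.1 : ℂ) e.2) ?_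
    (measure_iUnion_null fun e => volume_segment _ _)
  rintro z (hz | ⟨u, v, -, hz⟩)
  · exact mem_iUnion.2 ⟨(⟨z, hz⟩, ⟨z, hz⟩), left_mem_segment ℝ _ _⟩
  · exact mem_iUnion.2 ⟨(u, v), hz⟩

/-- Near a point `u`, the plane is covered by the closures of the faces that touch `u`. -/
theorem eventually_exists_mem_closure (hiso : G.IsIsoradial h) (u : ℂ) :
    ∀ᶠ z in 𝓝 u, ∃ F, G.IsFace F ∧ u ∈ closure F ∧ z ∈ closure F := by
  set S := {F | G.IsFace F ∧ G.corners F ⊆ Metric.closedBall u (h + 1)} with hS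
  have hfin : S.Finite := finite_faces_corners_subset hiso u (h + 1)
  have hclosed : IsClosed (⋃ F ∈ {F ∈ S | u ∉ closure F}, closure F) :=
    (hfin.subset (sep_subset _ _)).isClosed_biUnion fun _ _ => isClosed_closure
  have hnot : u ∉ ⋃ F ∈ {F ∈ S | u ∉ closure F}, closure F := by
    simp only [mem_iUnion, not_exists]
    exact fun F hF hu => hF.2 hu
  have hcover : Metric.ball u 1 ⊆ ⋃ F ∈ S, closure F := by
    have hclosed' : IsClosed (⋃ F ∈ S, closure F) :=
      hfin.isClosed_biUnion fun _ _ => isClosed_closure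
    refine ((dense_compl_skeleton (G := G)).open_subset_closure_inter Metric.isOpen_ball).trans
      (closure_minimal ?_ hclosed')
    rintro z ⟨hz, hzs⟩
    obtain ⟨F, hF, hzF⟩ := exists_isFace_mem hzs
    refine mem_biUnion ⟨hF, fun v hv => ?_⟩ (subset_closure hzF)
    have h1 := hF.dist_le hiso (IsFace.corners_subset_closure hv) (subset_closure hzF)
    rw [Metric.mem_closedBall]
    rw [Metric.mem_ball] at hz
    linarith [dist_triangle v z u]
  filter_upwards [Metric.ball_mem_nhds u one_pos, hclosed.isOpen_compl.mem_nhds hnot] with z hz hz'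
  obtain ⟨F, hF, hzF⟩ := mem_iUnion₂.1 (hcover hz)
  refine ⟨F, hF.1, ?_, hzF⟩
  by_contra hu
  exact hz' (mem_biUnion (show F ∈ {F ∈ S | u ∉ closure F} from ⟨hF, hu⟩) hzF)

theorem exists_mem_closure (hiso : G.IsIsoradial h) (z : ℂ) : ∃ F, G.IsFace F ∧ z ∈ closure F := by
  obtain ⟨F, hF, hz, -⟩ := (eventually_exists_mem_closure hiso z).self_of_nhds
  exact ⟨F, hF, hz⟩

theorem IsFace.not_subset_hyperplane (hiso : G.IsIsoradial h) (hF : G.IsFace F) {n : ℂ}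
    (hn : n ≠ 0) (k : ℝ) : ¬ ∀ v ∈ G.corners F, inner ℝ n v = k := by
  intro hk
  have hsub : F ⊆ {z | inner ℝ n z = k} := (hF.subset_convexHull hiso).trans
    (convexHull_min hk (convex_hyperplane (innerSL ℝ n).toLinearMap.isLinear k))
  obtain ⟨z, hz⟩ := hF.nonempty
  have hlim : Tendsto (fun ε : ℝ => z + ε • n) (𝓝[≠] 0) (𝓝 z) := by
    have : Continuous fun ε : ℝ => z + ε • n := by fun_prop
    exact (this.tendsto' 0 _ (by simp)).mono_left nhdsWithin_le_nhds
  obtain ⟨ε, hεF, hε⟩ := ((hlim.eventually ((hF.isOpen hiso).mem_nhds hz)).and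
    self_mem_nhdsWithin).exists
  have h1 : inner ℝ n z = k := hsub hz
  have h2 : inner ℝ n (z + ε • n) = k := hsub hεF
  rw [inner_add_right, h1, real_inner_smul_right, real_inner_self_eq_norm_sq] at h2
  have h3 : ε * ‖n‖ ^ 2 = 0 := by linarith
  simp_all

/-- The center of the circle through the corners of a face is unique, as the corners are not
collinear. -/
theorem IsFace.circumcenter_unique (hiso : G.IsIsoradial h) (hF : G.IsFace F) {c c' : ℂ}
    (hc : G.IsCircumcenter F c) (hc' : G.IsCircumcenter F c') : c = c' := by
  obtain ⟨r, hr⟩ := hc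
  obtain ⟨r', hr'⟩ := hc'
  by_contra hne
  refine hF.not_subset_hyperplane hiso (sub_ne_zero.2 hne)
    ((r' ^ 2 - r ^ 2 + ‖c‖ ^ 2 - ‖c'‖ ^ 2) / 2) fun v hv => ?_
  have h1 := hr v hv
  have h2 := hr' v hv
  rw [dist_eq_norm] at h1 h2
  have e1 := norm_sub_sq_real v c
  have e2 := norm_sub_sq_real v c'
  rw [h1] at e1
  rw [h2] at e2
  rw [inner_sub_left, real_inner_comm, real_inner_comm v c']
  linarith

theorem IsFace.circumcenter_spec (hiso : G.IsIsoradial h) (hF : G.IsFace F) {c : ℂ}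
    (hc : G.IsCircumcenter F c) : c ∈ F ∧ ∀ v ∈ G.corners F, dist v c = h / 2 := by
  obtain ⟨-, c', hc'F, hc'⟩ := hiso F hF
  obtain rfl := hF.circumcenter_unique hiso hc ⟨_, hc'⟩
  exact ⟨hc'F, hc'⟩

theorem exists_isCircumcenter (hiso : G.IsIsoradial h) (hF : G.IsFace F) :
    ∃ c, G.IsCircumcenter F c := by
  obtain ⟨-, c, -, hc⟩ := hiso F hF
  exact ⟨c, h / 2, hc⟩

/-- If a vertex `u` were not in the convex hull of the circumcenters around it, a small step from
`u` away from the hull would leave all the circumdisks of the faces around `u`. -/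
theorem vert_mem_convexHull_circumcenters (hiso : G.IsIsoradial h) (u : G.verts) :
    (u : ℂ) ∈ convexHull ℝ
      {c | ∃ F : Set ℂ, G.IsFace F ∧ (u : ℂ) ∈ frontier F ∧ G.IsCircumcenter F c} := by
  set C := {c | ∃ F : Set ℂ, G.IsFace F ∧ (u : ℂ) ∈ frontier F ∧ G.IsCircumcenter F c} with hC
  have hCne : C.Nonempty := by
    obtain ⟨F, hF, hu⟩ := exists_mem_closure hiso (u : ℂ)
    obtain ⟨c, hc⟩ := exists_isCircumcenter hiso hF
    exact ⟨c, F, hF, hF.mem_frontier hiso hu (vert_mem_skeleton u), hc⟩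
  have hCfin : C.Finite := by
    refine ((finite_faces_corners_subset hiso u h).biUnion
      (t := fun F => {c | G.IsCircumcenter F c})
      fun F hF => Set.Subsingleton.finite fun c hc c' hc' => ?_).subset ?_
    · exact hF.1.circumcenter_unique hiso hc hc'
    · rintro c ⟨F, hF, hu, hc⟩
      exact mem_biUnion ⟨hF, fun v hv => hF.dist_le hiso (IsFace.corners_subset_closure hv)
        (frontier_subset_closure hu)⟩ hc
  obtain ⟨w, hw, hmin⟩ := exists_norm_eq_iInf_of_complete_convex hCne.convexHull
    (hCfin.isCompact_convexHull ℝ).isComplete (convex_convexHull ℝ C) (u : ℂ)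
  rw [norm_eq_iInf_iff_real_inner_le_zero (convex_convexHull ℝ C) hw] at hmin
  by_contra hu
  have hwu : w - u ≠ 0 := sub_ne_zero.2 fun e => hu (e ▸ hw)
  have hlim : Tendsto (fun ε : ℝ => (u : ℂ) - ε * (w - u)) (𝓝[>] 0) (𝓝 u) := by
    have : Continuous fun ε : ℝ => (u : ℂ) - ε * (w - u) := by fun_prop
    exact (this.tendsto' 0 _ (by simp)).mono_left nhdsWithin_le_nhds
  obtain ⟨ε, ⟨F, hF, huF, hzF⟩, hε⟩ :=
    ((hlim.eventually (eventually_exists_mem_closure hiso (u : ℂ))).and self_mem_nhdsWithin).exists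
  replace hε : 0 < ε := hε
  obtain ⟨c, hc⟩ := exists_isCircumcenter hiso hF
  have hspec := hF.circumcenter_spec hiso hc
  have huf := hF.mem_frontier hiso huF (vert_mem_skeleton u)
  have hle := hF.closure_subset_closedBall hiso (fun v hv => (hspec.2 v hv).le) hzF
  have heq := hspec.2 u ⟨u.2, huf⟩
  have hin := hmin c (subset_convexHull ℝ C ⟨F, hF, huf, hc⟩)
  rw [Metric.mem_closedBall, ← heq, dist_eq_norm, dist_eq_norm] at hle
  have hsq : ‖(u : ℂ) - ε * (w - u) - c‖ ^ 2 ≤ ‖(u : ℂ) - c‖ ^ 2 := by gcongr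
  have e1 : (u : ℂ) - ε * (w - u) - c = (u - c) - ε • (w - u) := by
    rw [Complex.real_smul]; ring
  rw [e1, norm_sub_sq_real, real_inner_smul_right, norm_smul, mul_pow] at hsq
  have e2 : inner ℝ ((u : ℂ) - c) (w - u)
      = inner ℝ ((u : ℂ) - w) (c - w) - ‖w - u‖ ^ 2 := by
    rw [show (u : ℂ) - c = -((c - w) + (w - u)) by ring, show (u : ℂ) - w = -(w - u) by ring,
      inner_neg_left, inner_neg_left, inner_add_left, real_inner_self_eq_norm_sq,
      real_inner_comm]
    ring
  rw [e2] at hsq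
  have hpos : 0 < ‖w - u‖ ^ 2 := pow_pos (norm_pos_iff.2 hwu) 2
  have : 0 ≤ ‖ε‖ ^ 2 * ‖w - u‖ ^ 2 := by positivity
  nlinarith [mul_pos hε hpos, mul_nonneg hε.le (neg_nonneg.2 hin)]

end Faces

end PlaneGraph

/-! ### Planar geometry of a rhombus -/

section Rhombus

variable {u v : ℂ}

theorem midpoint_add_mem_segment {a : ℝ} (ha : 2 * |a| ≤ 1) :
    (u + v) / 2 + a * (v - u) ∈ segment ℝ u v := by
  have := abs_le.1 (show |a| ≤ 1 / 2 by linarith)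
  refine ⟨1 / 2 - a, 1 / 2 + a, by linarith, by linarith, by ring, ?_⟩
  simp only [Complex.real_smul]
  push_cast
  ring

theorem midpoint_add_mem_openSegment {a : ℝ} (ha : 2 * |a| < 1) :
    (u + v) / 2 + a * (v - u) ∈ openSegment ℝ u v := by
  have := abs_lt.1 (show |a| < 1 / 2 by linarith)
  refine ⟨1 / 2 - a, 1 / 2 + a, by linarith, by linarith, by ring, ?_⟩
  simp only [Complex.real_smul]
  push_cast
  ring

theorem exists_real_of_dist_eq (huv : u ≠ v) {c : ℂ} (h : dist u c = dist v c) :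
    ∃ k : ℝ, c = (u + v) / 2 + k * Complex.I * (v - u) := by
  have hne : v - u ≠ 0 := sub_ne_zero.2 huv.symm
  set ζ := (c - (u + v) / 2) / (v - u) with hζ
  have hc : c = (u + v) / 2 + ζ * (v - u) := by rw [hζ]; field_simp; ring
  have h1 : u - c = -((ζ + 1 / 2) * (v - u)) := by rw [hc]; ring
  have h2 : v - c = -((ζ - 1 / 2) * (v - u)) := by rw [hc]; ring
  rw [dist_eq_norm, dist_eq_norm, h1, h2, norm_neg, norm_neg, norm_mul, norm_mul] at h
  have h3 := mul_right_cancel₀ (norm_ne_zero_iff.2 hne) h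
  have h4 : Complex.normSq (ζ + 1 / 2) = Complex.normSq (ζ - 1 / 2) := by
    rw [Complex.normSq_eq_norm_sq, Complex.normSq_eq_norm_sq, h3]
  have hre : ζ.re = 0 := by
    simp [Complex.normSq_apply] at h4
    linarith
  refine ⟨ζ.im, ?_⟩
  conv_lhs => rw [hc, ← Complex.re_add_im ζ, hre]
  simp

/-- Two distinct points at the same distance from `u` and `v` are mirror images of each other in
the line through `u` and `v`. -/
theorem exists_rhombus (huv : u ≠ v) {c₁ c₂ : ℂ} {r : ℝ} (h1 : dist u c₁ = r) (h2 : dist v c₁ = r)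
    (h3 : dist u c₂ = r) (h4 : dist v c₂ = r) (hne : c₁ ≠ c₂) :
    ∃ k : ℝ, c₁ = (u + v) / 2 + k * Complex.I * (v - u) ∧
      c₂ = (u + v) / 2 + ((-k : ℝ) : ℂ) * Complex.I * (v - u) := by
  obtain ⟨k, hk⟩ := exists_real_of_dist_eq huv (h1.trans h2.symm)
  obtain ⟨l, hl⟩ := exists_real_of_dist_eq huv (h3.trans h4.symm)
  have hvu : v - u ≠ 0 := sub_ne_zero.2 huv.symm
  have e := h1.trans h3.symm
  have e1 : u - c₁ = (-(1 / 2) - k * Complex.I) * (v - u) := by rw [hk]; ring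
  have e2 : u - c₂ = (-(1 / 2) - l * Complex.I) * (v - u) := by rw [hl]; ring
  rw [dist_eq_norm, dist_eq_norm, e1, e2, norm_mul, norm_mul] at e
  have e3 := mul_right_cancel₀ (norm_ne_zero_iff.2 hvu) e
  have e4 : Complex.normSq (-(1 / 2) - k * Complex.I) =
      Complex.normSq (-(1 / 2) - l * Complex.I) := by
    rw [Complex.normSq_eq_norm_sq, Complex.normSq_eq_norm_sq, e3]
  have hkl : k * k = l * l := by
    simp [Complex.normSq_apply] at e4
    linarith
  have hlk : l = -k := by
    rcases mul_self_eq_mul_self_iff.1 hkl with h | h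
    · exact absurd (by rw [hk, hl, h]) hne
    · linarith
  exact ⟨k, hk, hlk ▸ hl⟩

/-- The open rhombus with diagonals `[u, v]` and `[c₁, c₂]` consists of the diagonal `(u, v)` and
two open triangles. -/
theorem rhombus_subset {F₁ F₂ : Set ℂ} (o₁ : IsOpen F₁) (o₂ : IsOpen F₂) (x₁ : Convex ℝ F₁)
    (x₂ : Convex ℝ F₂) (s₁ : segment ℝ u v ⊆ closure F₁) (s₂ : segment ℝ u v ⊆ closure F₂) {k : ℝ}
    (h₁ : (u + v) / 2 + k * Complex.I * (v - u) ∈ F₁)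
    (h₂ : (u + v) / 2 + ((-k : ℝ) : ℂ) * Complex.I * (v - u) ∈ F₂) {ζ : ℂ}
    (hζ : 2 * |ζ.re| * |k| + |ζ.im| < |k|) :
    (u + v) / 2 + ζ * (v - u) ∈ F₁ ∪ F₂ ∪ openSegment ℝ u v := by
  have key : ∀ {F : Set ℂ} {l : ℝ}, IsOpen F → Convex ℝ F → segment ℝ u v ⊆ closure F → l ≠ 0 →
      (u + v) / 2 + l * Complex.I * (v - u) ∈ F → 0 < ζ.im / l → ζ.im / l < 1 →
      2 * |ζ.re| ≤ 1 - ζ.im / l → (u + v) / 2 + ζ * (v - u) ∈ F := by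
    intro F l o x s hl hF h0 h1 h2
    set τ := ζ.im / l with hτ
    have h3 : 0 < 1 - τ := by linarith
    have hy : (u + v) / 2 + ((ζ.re / (1 - τ) : ℝ) : ℂ) * (v - u) ∈ closure F := by
      refine s (midpoint_add_mem_segment ?_)
      rw [abs_div, abs_of_pos h3, ← mul_div_assoc, div_le_one h3]
      exact h2
    rw [← o.interior_eq] at hF ⊢
    refine x.openSegment_interior_closure_subset_interior hF hy
      ⟨τ, 1 - τ, h0, h3, by ring, ?_⟩
    have him : τ * l = ζ.im := by rw [hτ]; field_simp
    have hre : (1 - τ) * (ζ.re / (1 - τ)) = ζ.re := by field_simp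
    simp only [Complex.real_smul]
    have him' : (τ : ℂ) * l = ζ.im := by exact_mod_cast him
    have hre' : ((1 - τ : ℝ) : ℂ) * ((ζ.re / (1 - τ) : ℝ) : ℂ) = ζ.re := by exact_mod_cast hre
    conv_rhs => rw [← Complex.re_add_im ζ, ← him', ← hre']
    push_cast
    ring
  have hk : k ≠ 0 := by
    rintro rfl
    simp only [abs_zero, mul_zero, zero_add] at hζ
    exact absurd hζ (abs_nonneg _).not_gt
  have hk' : 0 < |k| := abs_pos.2 hk
  have hlt : 2 * |ζ.re| + |ζ.im| / |k| < 1 := by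
    rw [← lt_sub_iff_add_lt', div_lt_iff₀ hk']
    linarith
  have hdiv : |ζ.im / k| = |ζ.im| / |k| := abs_div _ _
  have habs := abs_nonneg ζ.re
  rcases lt_trichotomy (ζ.im / k) 0 with hneg | hzero | hpos
  · rw [abs_of_neg hneg] at hdiv
    refine Or.inl (Or.inr (key o₂ x₂ s₂ (neg_ne_zero.2 hk) h₂ ?_ ?_ ?_)) <;>
      rw [div_neg] <;> linarith
  · have him : ζ.im = 0 := by simpa [hk] using hzero
    refine Or.inr ?_
    rw [← Complex.re_add_im ζ, him, Complex.ofReal_zero, zero_mul, add_zero]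
    exact midpoint_add_mem_openSegment (by rw [him] at hlt; simpa using hlt)
  · rw [abs_of_pos hpos] at hdiv
    exact Or.inl (Or.inl (key o₁ x₁ s₁ hk h₁ hpos (by linarith) (by linarith)))

/-- The point at a quarter of the way from `u` to `v`. -/
noncomputable def quarterPoint (u v : ℂ) : ℂ := u + (v - u) / 4

theorem exists_of_mem_ball_quarterPoint {k r : ℝ} (h1 : 8 * r ≤ ‖v - u‖)
    (h2 : 4 * r ≤ |k| * ‖v - u‖)
    {z : ℂ} (hz : z ∈ Metric.ball (quarterPoint u v) r) :
    ∃ η : ℂ, z = (u + v) / 2 + (η - 1 / 4) * (v - u) ∧ |η.re| < 1 / 8 ∧ |η.im| < |k| / 4 := by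
  rw [Metric.mem_ball, dist_eq_norm] at hz
  have hpos : 0 < ‖v - u‖ := by linarith [norm_nonneg (z - quarterPoint u v)]
  have hne : v - u ≠ 0 := norm_pos_iff.1 hpos
  have hη : ‖(z - quarterPoint u v) / (v - u)‖ < r / ‖v - u‖ := by
    rw [norm_div]
    gcongr
  refine ⟨(z - quarterPoint u v) / (v - u), ?_, ?_, ?_⟩
  · rw [quarterPoint]
    field_simp
    ring
  · refine ((Complex.abs_re_le_norm _).trans_lt hη).trans_le ?_
    rw [div_le_div_iff₀ hpos (by norm_num)]
    linarith
  · refine ((Complex.abs_im_le_norm _).trans_lt hη).trans_le ?_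
    rw [div_le_div_iff₀ hpos (by norm_num)]
    linarith

theorem ball_quarterPoint_subset_rhombus {F₁ F₂ : Set ℂ} (o₁ : IsOpen F₁) (o₂ : IsOpen F₂)
    (x₁ : Convex ℝ F₁) (x₂ : Convex ℝ F₂) (s₁ : segment ℝ u v ⊆ closure F₁)
    (s₂ : segment ℝ u v ⊆ closure F₂) {k r : ℝ}
    (h₁ : (u + v) / 2 + k * Complex.I * (v - u) ∈ F₁)
    (h₂ : (u + v) / 2 + ((-k : ℝ) : ℂ) * Complex.I * (v - u) ∈ F₂)
    (hr : 8 * r ≤ ‖v - u‖) (hk : 4 * r ≤ |k| * ‖v - u‖) :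
    Metric.ball (quarterPoint u v) r ⊆ F₁ ∪ F₂ ∪ openSegment ℝ u v := by
  intro z hz
  obtain ⟨η, rfl, hre, him⟩ := exists_of_mem_ball_quarterPoint hr hk hz
  refine rhombus_subset o₁ o₂ x₁ x₂ s₁ s₂ h₁ h₂ ?_
  have hre' : |(η - 1 / 4).re| ≤ 3 / 8 := by
    simp only [Complex.sub_re, Complex.div_ofNat_re, Complex.one_re]
    refine (abs_sub _ _).trans ?_
    rw [abs_of_pos (by norm_num : (0 : ℝ) < 1 / 4)]
    linarith
  have him' : (η - 1 / 4).im = η.im := by simp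
  rw [him']
  nlinarith [abs_nonneg k]

theorem ball_quarterPoint_subset_triangle {K : Set ℂ} (hK : Convex ℝ K) {k r : ℝ} (hu : u ∈ K)
    (h₁ : (u + v) / 2 + k * Complex.I * (v - u) ∈ K)
    (h₂ : (u + v) / 2 + ((-k : ℝ) : ℂ) * Complex.I * (v - u) ∈ K)
    (hr : 8 * r ≤ ‖v - u‖) (hk : 4 * r ≤ |k| * ‖v - u‖) :
    Metric.ball (quarterPoint u v) r ⊆ K := by
  intro z hz
  obtain ⟨η, rfl, hre, him⟩ := exists_of_mem_ball_quarterPoint hr hk hz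
  have hk0 : 0 < |k| := by linarith [abs_nonneg η.im]
  have hk1 : k ≠ 0 := abs_pos.1 hk0
  -- the barycentric weight of `u` is `1 - s`
  set s := 1 / 2 + 2 * η.re with hs
  set τ := η.im / k / s with hτ
  obtain ⟨hre1, hre2⟩ := abs_lt.1 hre
  have hs0 : 0 < s := by linarith
  have hτ1 : |τ| ≤ 1 := by
    rw [hτ, abs_div, abs_div, abs_of_pos hs0, div_div, div_le_one (by positivity)]
    nlinarith
  obtain ⟨hτ2, hτ3⟩ := abs_le.1 hτ1
  have hy := hK h₁ h₂ (a := (1 + τ) / 2) (b := (1 - τ) / 2) (by linarith) (by linarith) (by ring)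
  have hz := hK hu hy (a := 1 - s) (b := s) (by linarith) hs0.le (by ring)
  convert hz using 1
  have h3 : s * τ * k = η.im := by rw [hτ]; field_simp
  have h3' : (s : ℂ) * τ * k = η.im := by exact_mod_cast h3
  have hs' : (s : ℂ) = 1 / 2 + 2 * η.re := by rw [hs]; push_cast; ring
  simp only [Complex.real_smul]
  conv_lhs => rw [← Complex.re_add_im η, ← h3', show (η.re : ℂ) = (s - 1 / 2) / 2 by rw [hs']; ring]
  push_cast
  ring

end Rhombus

theorem volume_real_ball (a : ℂ) {s : ℝ} (hs : 0 ≤ s) :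
    (volume : Measure ℂ).real (Metric.ball a s) = s ^ 2 * Real.pi := by
  rw [Measure.real, Complex.volume_ball, ENNReal.toReal_mul, ENNReal.toReal_pow,
    ENNReal.toReal_ofReal hs]
  rfl

theorem card_le_of_separated {ι : Type*} (S : Finset ι) (f : ι → ℂ) {p : ℂ} {r R : ℝ} (hr : 0 < r)
    (hsep : ∀ i ∈ S, ∀ j ∈ S, i ≠ j → r ≤ dist (f i) (f j)) (hR : ∀ i ∈ S, dist (f i) p ≤ R) :
    (S.card : ℝ) ≤ (2 * R / r + 1) ^ 2 := by
  rcases S.eq_empty_or_nonempty with rfl | ⟨i₀, hi₀⟩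
  · simpa using sq_nonneg _
  have hR0 : 0 ≤ R := dist_nonneg.trans (hR i₀ hi₀)
  have hdisj : (S : Set ι).PairwiseDisjoint fun i => Metric.ball (f i) (r / 2) := by
    intro i hi j hj hij
    exact Metric.ball_disjoint_ball (by linarith [hsep i hi j hj hij])
  have hle : (volume : Measure ℂ).real (⋃ i ∈ S, Metric.ball (f i) (r / 2))
      ≤ (volume : Measure ℂ).real (Metric.ball p (R + r / 2)) := by
    refine measureReal_mono (iUnion₂_subset fun i hi => ?_) measure_ball_lt_top.ne
    exact Metric.ball_subset_ball' (by linarith [hR i hi])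
  rw [measureReal_biUnion_finset hdisj (fun _ _ => measurableSet_ball)
    (fun _ _ => measure_ball_lt_top.ne),
    Finset.sum_congr rfl fun i _ => volume_real_ball (f i) (s := r / 2) (by positivity),
    volume_real_ball _ (by positivity), Finset.sum_const, nsmul_eq_mul, ← mul_assoc] at hle
  have h1 := le_of_mul_le_mul_right hle Real.pi_pos
  have h2 : (2 * R / r + 1) ^ 2 = (R + r / 2) ^ 2 / (r / 2) ^ 2 := by
    rw [← div_pow]
    congr 1
    field_simp
  rw [h2, le_div_iff₀ (by positivity)]
  exact h1

namespace PlaneGraph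

/-! ### Edges, degrees and jump rates -/

/-- The graph is isoradial with circumdiameter `h`, and its edges and dual edges have length at
least `cp * h` and `cd * h` respectively. -/
structure IsBoundedIsoradial (G : PlaneGraph) (h cp cd : ℝ) : Prop where
  pos : 0 < h
  cp_pos : 0 < cp
  cd_pos : 0 < cd
  iso : G.IsIsoradial h
  le_edge : ∀ u v : G.verts, G.graph.Adj u v → cp * h ≤ G.edgeLength u v
  le_dual : ∀ u v : G.verts, G.graph.Adj u v → cd * h ≤ G.dualEdgeLength u v

/-- In units of `h`, the radius of the disks around the quarter points of edges which fit into the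
rhombi of these edges. -/
noncomputable def sepConst (cp cd : ℝ) : ℝ := min (cp / 8) (cd / 16)

/-- A bound for the number of oriented edges starting in a disk of radius `R * h`. -/
noncomputable def packConst (cp cd R : ℝ) : ℝ := (2 * (R + 1) / sepConst cp cd + 1) ^ 2

theorem corner_of_segment_subset {G : PlaneGraph} {F : Set ℂ} {u v : G.verts}
    (hs : segment ℝ (u : ℂ) v ⊆ frontier F) : (u : ℂ) ∈ G.corners F ∧ (v : ℂ) ∈ G.corners F :=
  ⟨⟨u.2, hs (left_mem_segment ℝ _ _)⟩, ⟨v.2, hs (right_mem_segment ℝ _ _)⟩⟩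

theorem coe_ne_of_adj {G : PlaneGraph} {u v : G.verts} (huv : G.graph.Adj u v) : (u : ℂ) ≠ v :=
  fun e => huv.ne (Subtype.ext e)

theorem quarterPoint_mem_openSegment (u v : ℂ) : quarterPoint u v ∈ openSegment ℝ u v :=
  ⟨3 / 4, 1 / 4, by norm_num, by norm_num, by norm_num, by
    simp only [quarterPoint, Complex.real_smul]; push_cast; ring⟩

theorem dist_quarterPoint (u v : ℂ) : dist (quarterPoint u v) u = dist u v / 4 := by
  rw [dist_comm u v, dist_eq_norm, dist_eq_norm, quarterPoint, add_sub_cancel_left, norm_div]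
  norm_num

namespace IsBoundedIsoradial

variable {G : PlaneGraph} {h cp cd : ℝ}

theorem sepConst_pos (H : G.IsBoundedIsoradial h cp cd) : 0 < sepConst cp cd :=
  lt_min (div_pos H.cp_pos (by norm_num)) (div_pos H.cd_pos (by norm_num))

theorem dist_circumcenter (H : G.IsBoundedIsoradial h cp cd) {u v : G.verts} {c : ℂ}
    (hc : c ∈ G.dualEdgeEnds u v) : dist (u : ℂ) c = h / 2 ∧ dist (v : ℂ) c = h / 2 := by
  obtain ⟨F, hF, hs, hc⟩ := hc
  have hspec := hF.circumcenter_spec H.iso hc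
  exact ⟨hspec.2 _ (corner_of_segment_subset hs).1, hspec.2 _ (corner_of_segment_subset hs).2⟩

theorem dualEdgeLength_le (H : G.IsBoundedIsoradial h cp cd) (u v : G.verts) :
    G.dualEdgeLength u v ≤ h := by
  refine Metric.diam_le_of_forall_dist_le H.pos.le fun c hc c' hc' => ?_
  linarith [dist_triangle_left c c' (u : ℂ), (H.dist_circumcenter hc).1,
    (H.dist_circumcenter hc').1]

/-- Every edge lies between two faces whose centers are mirror images of each other; `k` is half of
the ratio `|e*| / |e|`, up to a sign. -/
theorem exists_faces_of_adj (H : G.IsBoundedIsoradial h cp cd) {u v : G.verts}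
    (huv : G.graph.Adj u v) : ∃ (F₁ F₂ : Set ℂ) (k : ℝ), G.IsFace F₁ ∧ G.IsFace F₂ ∧
      segment ℝ (u : ℂ) v ⊆ frontier F₁ ∧ segment ℝ (u : ℂ) v ⊆ frontier F₂ ∧
      G.IsCircumcenter F₁ (((u : ℂ) + v) / 2 + k * Complex.I * (v - u)) ∧
      G.IsCircumcenter F₂ (((u : ℂ) + v) / 2 + ((-k : ℝ) : ℂ) * Complex.I * (v - u)) ∧
      8 * (sepConst cp cd * h) ≤ ‖(v : ℂ) - u‖ ∧
      4 * (sepConst cp cd * h) ≤ |k| * ‖(v : ℂ) - u‖ := by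
  have hpos : 0 < cd * h := mul_pos H.cd_pos H.pos
  obtain ⟨c₁, hc₁, c₂, hc₂, hdist⟩ : ∃ c₁ ∈ G.dualEdgeEnds u v, ∃ c₂ ∈ G.dualEdgeEnds u v,
      cd * h / 2 < dist c₁ c₂ := by
    by_contra! hcon
    have h1 : G.dualEdgeLength u v ≤ cd * h / 2 :=
      Metric.diam_le_of_forall_dist_le (by positivity) hcon
    linarith [H.le_dual u v huv]
  have hne : c₁ ≠ c₂ := dist_pos.1 (by linarith)
  obtain ⟨k, h1, h2⟩ := exists_rhombus (coe_ne_of_adj huv) (H.dist_circumcenter hc₁).1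
    (H.dist_circumcenter hc₁).2 (H.dist_circumcenter hc₂).1 (H.dist_circumcenter hc₂).2 hne
  have h3 : dist c₁ c₂ = 2 * (|k| * ‖(v : ℂ) - u‖) := by
    have e : c₁ - c₂ = (2 * k : ℝ) * Complex.I * ((v : ℂ) - u) := by
      rw [h1, h2]
      push_cast
      ring
    rw [dist_eq_norm, e, norm_mul, norm_mul, Complex.norm_real, Complex.norm_I, norm_mul,
      Real.norm_eq_abs, Real.norm_eq_abs, abs_two]
    ring
  obtain ⟨F₁, hF₁, s₁, hc₁⟩ := hc₁
  obtain ⟨F₂, hF₂, s₂, hc₂⟩ := hc₂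
  have hs1 : sepConst cp cd * h ≤ cp / 8 * h :=
    mul_le_mul_of_nonneg_right (min_le_left _ _) H.pos.le
  have hs2 : sepConst cp cd * h ≤ cd / 16 * h :=
    mul_le_mul_of_nonneg_right (min_le_right _ _) H.pos.le
  refine ⟨F₁, F₂, k, hF₁, hF₂, s₁, s₂, h1 ▸ hc₁, h2 ▸ hc₂, ?_, ?_⟩
  · have := H.le_edge u v huv
    rw [edgeLength, dist_comm, dist_eq_norm] at this
    linarith
  · linarith

theorem dist_le_of_adj (H : G.IsBoundedIsoradial h cp cd) {u v : G.verts}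
    (huv : G.graph.Adj u v) : dist (u : ℂ) v ≤ h := by
  obtain ⟨F, -, -, hF, -, hs, -⟩ := H.exists_faces_of_adj huv
  exact hF.dist_le H.iso (frontier_subset_closure (hs (left_mem_segment ℝ _ _)))
    (frontier_subset_closure (hs (right_mem_segment ℝ _ _)))

/-- Only the two faces next to an edge come close to an interior point of the edge. -/
theorem segment_subset_frontier (H : G.IsBoundedIsoradial h cp cd) {u v : G.verts}
    (huv : G.graph.Adj u v) {F : Set ℂ} (hF : G.IsFace F) {z : ℂ}
    (hz : z ∈ openSegment ℝ (u : ℂ) v) (hzF : z ∈ closure F) :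
    segment ℝ (u : ℂ) v ⊆ frontier F := by
  obtain ⟨F₁, F₂, k, hF₁, hF₂, s₁, s₂, c₁, c₂, -, hk⟩ := H.exists_faces_of_adj huv
  have hk0 : k ≠ 0 := by
    rintro rfl
    have := mul_pos H.sepConst_pos H.pos
    simp at hk
    linarith
  have hne : (v : ℂ) - u ≠ 0 := sub_ne_zero.2 (coe_ne_of_adj huv).symm
  set ζ : ℂ → ℂ := fun w => (w - ((u : ℂ) + v) / 2) / (v - u) with hζ
  have hw : ∀ w, w = ((u : ℂ) + v) / 2 + ζ w * (v - u) := by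
    intro w
    rw [hζ]
    field_simp
    ring
  have hcont : Continuous fun w => 2 * |(ζ w).re| * |k| + |(ζ w).im| := by
    have : Continuous ζ := by fun_prop
    fun_prop
  have hopen : IsOpen {w | 2 * |(ζ w).re| * |k| + |(ζ w).im| < |k|} :=
    isOpen_lt hcont continuous_const
  have hmem : z ∈ {w | 2 * |(ζ w).re| * |k| + |(ζ w).im| < |k|} := by
    obtain ⟨a, b, ha, hb, hab, rfl⟩ := hz
    have e : ζ (a • (u : ℂ) + b • (v : ℂ)) = ((b - 1 / 2 : ℝ) : ℂ) := by
      rw [hζ]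
      obtain rfl : a = 1 - b := by linarith
      simp only [Complex.real_smul]
      field_simp
      push_cast
      ring
    have hb2 : |b - 1 / 2| < 1 / 2 := by
      rw [abs_lt]
      constructor <;> linarith
    simp only [mem_ofPred_eq, e, Complex.ofReal_re, Complex.ofReal_im, abs_zero, add_zero]
    have := abs_pos.2 hk0
    nlinarith
  obtain ⟨w, hwR, hwF⟩ := mem_closure_iff.1 hzF _ hopen hmem
  have hsub := rhombus_subset (hF₁.isOpen H.iso) (hF₂.isOpen H.iso) (hF₁.convex H.iso)
    (hF₂.convex H.iso) (s₁.trans frontier_subset_closure) (s₂.trans frontier_subset_closure)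
    (hF₁.circumcenter_spec H.iso c₁).1 (hF₂.circumcenter_spec H.iso c₂).1 hwR
  rw [← hw] at hsub
  rcases hsub with (h1 | h2) | h3
  · rwa [hF.eq_of_mem hF₁ hwF h1]
  · rwa [hF.eq_of_mem hF₂ hwF h2]
  · exact absurd (segment_subset_skeleton huv (openSegment_subset_segment ℝ _ _ h3))
      (hF.notMem_skeleton hwF)

/-- The disk around the quarter point of an edge meets no other edge. -/
theorem le_dist_quarterPoint (H : G.IsBoundedIsoradial h cp cd) {u v u' v' : G.verts}
    (huv : G.graph.Adj u v) (huv' : G.graph.Adj u' v') (hne : (u, v) ≠ (u', v')) :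
    sepConst cp cd * h ≤ dist (quarterPoint (u' : ℂ) v') (quarterPoint (u : ℂ) v) := by
  obtain ⟨F₁, F₂, k, hF₁, hF₂, s₁, s₂, c₁, c₂, hr, hk⟩ := H.exists_faces_of_adj huv
  have hpos := mul_pos H.sepConst_pos H.pos
  by_cases hsym : s(u, v) = s(u', v')
  · obtain ⟨rfl, rfl⟩ | ⟨rfl, rfl⟩ := Sym2.eq_iff.1 hsym
    · exact absurd rfl hne
    · have e : quarterPoint (v : ℂ) u - quarterPoint (u : ℂ) v = ((v : ℂ) - u) / 2 := by
        rw [quarterPoint, quarterPoint]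
        ring
      rw [dist_eq_norm, e, norm_div]
      norm_num
      linarith
  · by_contra! hlt
    have hsub := ball_quarterPoint_subset_rhombus (hF₁.isOpen H.iso) (hF₂.isOpen H.iso)
      (hF₁.convex H.iso) (hF₂.convex H.iso) (s₁.trans frontier_subset_closure)
      (s₂.trans frontier_subset_closure) (hF₁.circumcenter_spec H.iso c₁).1
      (hF₂.circumcenter_spec H.iso c₂).1 hr hk hlt
    have hq := quarterPoint_mem_openSegment (u' : ℂ) v'
    have hsk := segment_subset_skeleton huv' (openSegment_subset_segment ℝ _ _ hq)
    rcases hsub with (h1 | h2) | h3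
    · exact hF₁.notMem_skeleton h1 hsk
    · exact hF₂.notMem_skeleton h2 hsk
    · exact disjoint_left.1 (G.no_crossing u v u' v' huv huv' hsym) h3 hq

theorem card_edges_le (H : G.IsBoundedIsoradial h cp cd) {R : ℝ} {p : ℂ}
    (S : Finset (G.verts × G.verts)) (hadj : ∀ e ∈ S, G.graph.Adj e.1 e.2)
    (hR : ∀ e ∈ S, dist (e.1 : ℂ) p ≤ R * h) : (S.card : ℝ) ≤ packConst cp cd R := by
  have hpos := mul_pos H.sepConst_pos H.pos
  have hcard := card_le_of_separated S (fun e => quarterPoint (e.1 : ℂ) e.2) (p := p)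
    (R := (R + 1) * h) hpos
    (fun e he e' he' hne => H.le_dist_quarterPoint (hadj e' he') (hadj e he) hne.symm)
    fun e he => by
      have h1 := dist_quarterPoint (e.1 : ℂ) e.2
      have h2 := H.dist_le_of_adj (hadj e he)
      linarith [dist_triangle (quarterPoint (e.1 : ℂ) e.2) e.1 p, hR e he, H.pos]
  refine hcard.trans_eq ?_
  have := H.sepConst_pos.ne'
  have := H.pos.ne'
  rw [packConst]
  field_simp

theorem finite_neighborSet (H : G.IsBoundedIsoradial h cp cd) (u : G.verts) :
    (G.graph.neighborSet u).Finite := by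
  refine Set.Finite.of_finite_image (f := Subtype.val)
    ((finite_verts_inter_closedBall (G := G) (u : ℂ) h).subset ?_) Subtype.val_injective.injOn
  rintro _ ⟨v, hv, rfl⟩
  refine ⟨v.2, ?_⟩
  rw [Metric.mem_closedBall, dist_comm]
  exact H.dist_le_of_adj hv

theorem dualFace_subset_closedBall (H : G.IsBoundedIsoradial h cp cd) (u : G.verts) :
    G.dualFace u ⊆ Metric.closedBall u (h / 2) := by
  refine interior_subset.trans (convexHull_min ?_ (convex_closedBall _ _))
  rintro c ⟨F, hF, hu, hc⟩
  rw [Metric.mem_closedBall, dist_comm, (hF.circumcenter_spec H.iso hc).2 u ⟨u.2, hu⟩]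

theorem dualArea_le (H : G.IsBoundedIsoradial h cp cd) (u : G.verts) : G.dualArea u ≤ 4 * h ^ 2 := by
  have hsub : G.dualFace u ⊆ Metric.ball (u : ℂ) h := (H.dualFace_subset_closedBall u).trans
    (Metric.closedBall_subset_ball (by linarith [H.pos]))
  refine (measureReal_mono hsub measure_ball_lt_top.ne).trans ?_
  rw [volume_real_ball _ H.pos.le, mul_comm]
  exact mul_le_mul_of_nonneg_right Real.pi_le_four (sq_nonneg h)

/-- The dual face of `u` contains the triangle spanned by `u` and the dual of any edge at `u`. -/
theorem le_dualArea (H : G.IsBoundedIsoradial h cp cd) {u v : G.verts} (huv : G.graph.Adj u v) :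
    (sepConst cp cd * h) ^ 2 ≤ G.dualArea u := by
  obtain ⟨F₁, F₂, k, hF₁, hF₂, s₁, s₂, c₁, c₂, hr, hk⟩ := H.exists_faces_of_adj huv
  have hpos := mul_pos H.sepConst_pos H.pos
  have hsub : Metric.ball (quarterPoint (u : ℂ) v) (sepConst cp cd * h) ⊆ G.dualFace u := by
    refine interior_maximal (ball_quarterPoint_subset_triangle (convex_convexHull ℝ _)
      (vert_mem_convexHull_circumcenters H.iso u) (subset_convexHull ℝ _ ?_)
      (subset_convexHull ℝ _ ?_) hr hk) Metric.isOpen_ball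
    · exact ⟨F₁, hF₁, s₁ (left_mem_segment ℝ _ _), c₁⟩
    · exact ⟨F₂, hF₂, s₂ (left_mem_segment ℝ _ _), c₂⟩
  have hfin : volume (G.dualFace u) ≠ ⊤ :=
    measure_ne_top_of_subset (H.dualFace_subset_closedBall u) measure_closedBall_lt_top.ne
  refine le_trans ?_ (measureReal_mono hsub hfin)
  rw [volume_real_ball _ hpos.le]
  nlinarith [Real.pi_gt_three, sq_nonneg (sepConst cp cd * h)]

theorem le_rate (H : G.IsBoundedIsoradial h cp cd) {u v : G.verts} (huv : G.graph.Adj u v) :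
    cd / 4 / h ^ 2 ≤ G.rate u v := by
  have hp := H.pos
  have hA := lt_of_lt_of_le (pow_pos (mul_pos H.sepConst_pos H.pos) 2) (H.le_dualArea huv)
  have hE := lt_of_lt_of_le (mul_pos H.cp_pos H.pos) (H.le_edge u v huv)
  have hE' : G.edgeLength u v ≤ h := H.dist_le_of_adj huv
  rw [rate, weight, div_div, div_div, div_le_div_iff₀ (by positivity) (by positivity)]
  calc cd * (G.edgeLength u v * G.dualArea u) ≤ cd * (h * (4 * h ^ 2)) := by
        have := H.cd_pos
        have := H.dualArea_le u
        gcongr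
    _ = cd * h * (4 * h ^ 2) := by ring
    _ ≤ _ := by
        gcongr
        exact H.le_dual u v huv

theorem rate_le (H : G.IsBoundedIsoradial h cp cd) {u v : G.verts} (huv : G.graph.Adj u v) :
    G.rate u v ≤ 1 / (cp * sepConst cp cd ^ 2) / h ^ 2 := by
  have hp := H.pos
  have hs := H.sepConst_pos
  have hc := H.cp_pos
  rw [rate, weight, div_div]
  calc G.dualEdgeLength u v / (G.edgeLength u v * G.dualArea u)
      ≤ h / (cp * h * (sepConst cp cd * h) ^ 2) := by
        have := H.dualEdgeLength_le u v
        have hE := H.le_edge u v huv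
        have hE0 : 0 ≤ G.edgeLength u v := le_trans (by positivity) hE
        have := H.le_dualArea huv
        gcongr
    _ = _ := by field_simp

theorem sum_rate_le (H : G.IsBoundedIsoradial h cp cd) (u : G.verts) :
    ∑ v ∈ (H.finite_neighborSet u).toFinset, G.rate u v
      ≤ packConst cp cd 0 * (1 / (cp * sepConst cp cd ^ 2)) / h ^ 2 := by
  have hp := H.pos
  have hs := H.sepConst_pos
  have hc := H.cp_pos
  set S := (H.finite_neighborSet u).toFinset with hS
  have hadj : ∀ v ∈ S, G.graph.Adj u v := fun v hv => by simpa [hS] using hv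
  have hcard : (S.card : ℝ) ≤ packConst cp cd 0 := by
    have hinj : Function.Injective fun v : G.verts => (u, v) := Prod.mk_right_injective u
    rw [← Finset.card_map ⟨_, hinj⟩]
    refine H.card_edges_le (R := 0) (p := u) _ (fun e he => ?_) fun e he => ?_ <;>
      obtain ⟨v, hv, rfl⟩ := Finset.mem_map.1 he
    · exact hadj v hv
    · simp
  calc ∑ v ∈ S, G.rate u v ≤ S.card • (1 / (cp * sepConst cp cd ^ 2) / h ^ 2) :=
        Finset.sum_le_card_nsmul _ _ _ fun v hv => H.rate_le (hadj v hv)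
    _ ≤ packConst cp cd 0 * (1 / (cp * sepConst cp cd ^ 2) / h ^ 2) := by
        rw [nsmul_eq_mul]
        gcongr
    _ = _ := by ring

end IsBoundedIsoradial

end PlaneGraph

namespace PlaneGraph

/-! ### Connectedness and graph distance -/

/-- The vertices `u` and `v` are joined by a walk all of whose vertices lie in `T`. -/
def ConnectedWithin (G : PlaneGraph) (T : Set ℂ) (u v : G.verts) : Prop :=
  ∃ p : G.graph.Walk u v, ∀ w ∈ p.support, (w : ℂ) ∈ T

namespace ConnectedWithin

variable {G : PlaneGraph} {T T' : Set ℂ} {u v w : G.verts}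

theorem refl (hu : (u : ℂ) ∈ T) : G.ConnectedWithin T u u :=
  ⟨.nil, fun w hw => by
    rw [SimpleGraph.Walk.support_nil, List.mem_singleton] at hw
    rwa [hw]⟩

theorem symm (h : G.ConnectedWithin T u v) : G.ConnectedWithin T v u := by
  obtain ⟨p, hp⟩ := h
  exact ⟨p.reverse, fun w hw => hp w (by simpa using hw)⟩

theorem trans (h : G.ConnectedWithin T u v) (h' : G.ConnectedWithin T v w) :
    G.ConnectedWithin T u w := by
  obtain ⟨p, hp⟩ := h
  obtain ⟨q, hq⟩ := h'
  refine ⟨p.append q, fun x hx => ?_⟩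
  rcases SimpleGraph.Walk.mem_support_append_iff _ _ |>.1 hx with hx | hx
  exacts [hp x hx, hq x hx]

theorem mono (h : G.ConnectedWithin T u v) (hT : T ⊆ T') : G.ConnectedWithin T' u v := by
  obtain ⟨p, hp⟩ := h
  exact ⟨p, fun w hw => hT (hp w hw)⟩

theorem of_adj (huv : G.graph.Adj u v) (hu : (u : ℂ) ∈ T) (hv : (v : ℂ) ∈ T) :
    G.ConnectedWithin T u v :=
  ⟨huv.toWalk, fun w hw => by
    simp only [SimpleGraph.Adj.toWalk, SimpleGraph.Walk.support_cons,
      SimpleGraph.Walk.support_nil, List.mem_cons, List.not_mem_nil, or_false] at hw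
    rcases hw with rfl | rfl <;> assumption⟩

end ConnectedWithin

/-- The part of the drawing that is spanned by a set `K` of vertices. -/
def inducedSkeleton (G : PlaneGraph) (K : Set G.verts) : Set ℂ :=
  ⋃ e ∈ {e : G.verts × G.verts | e.1 ∈ K ∧ e.2 ∈ K ∧ (e.1 = e.2 ∨ G.graph.Adj e.1 e.2)},
    segment ℝ (e.1 : ℂ) e.2

section

variable {G : PlaneGraph}

theorem vert_mem_inducedSkeleton {K : Set G.verts} {u : G.verts} (hu : u ∈ K) :
    (u : ℂ) ∈ G.inducedSkeleton K :=
  mem_iUnion₂.2 ⟨(u, u), ⟨hu, hu, Or.inl rfl⟩, left_mem_segment ℝ _ _⟩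

theorem segment_subset_inducedSkeleton {K : Set G.verts} {u v : G.verts} (hu : u ∈ K) (hv : v ∈ K)
    (huv : G.graph.Adj u v) : segment ℝ (u : ℂ) v ⊆ G.inducedSkeleton K :=
  fun _ hz => mem_iUnion₂.2 ⟨(u, v), ⟨hu, hv, Or.inr huv⟩, hz⟩

theorem isClosed_inducedSkeleton {K : Set G.verts} (hK : K.Finite) :
    IsClosed (G.inducedSkeleton K) := by
  refine Set.Finite.isClosed_biUnion ((hK.prod hK).subset fun e he => ⟨he.1, he.2.1⟩) fun e _ => ?_
  rw [← convexHull_pair]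
  exact ((Set.toFinite _).isCompact_convexHull ℝ).isClosed

theorem mem_inducedSkeleton {K : Set G.verts} {z : ℂ} (hz : z ∈ G.inducedSkeleton K) :
    (∃ u ∈ K, (u : ℂ) = z) ∨
      ∃ u ∈ K, ∃ v ∈ K, G.graph.Adj u v ∧ z ∈ openSegment ℝ (u : ℂ) v := by
  obtain ⟨⟨u, v⟩, ⟨hu, hv, huv⟩, hz⟩ := mem_iUnion₂.1 hz
  rw [← insert_endpoints_openSegment, mem_insert_iff, mem_insert_iff] at hz
  rcases hz with rfl | rfl | hz
  · exact Or.inl ⟨u, hu, rfl⟩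
  · exact Or.inl ⟨v, hv, rfl⟩
  · rcases huv with huv | huv
    · obtain rfl : u = v := huv
      rw [openSegment_same] at hz
      exact Or.inl ⟨u, hu, hz.symm⟩
    · exact Or.inr ⟨u, hu, v, hv, huv, hz⟩

theorem disjoint_inducedSkeleton {K L : Set G.verts} (hKL : Disjoint K L) :
    Disjoint (G.inducedSkeleton K) (G.inducedSkeleton L) := by
  rw [disjoint_left] at hKL ⊢
  intro z hz hz'
  rcases mem_inducedSkeleton hz with ⟨u, hu, rfl⟩ | ⟨u, hu, v, hv, huv, hz⟩ <;>
    rcases mem_inducedSkeleton hz' with ⟨u', hu', e⟩ | ⟨u', hu', v', hv', huv', hz'⟩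
  · exact hKL hu (Subtype.ext e ▸ hu')
  · exact G.no_vertex_inside_edge u' v' u huv' hz'
  · exact G.no_vertex_inside_edge u v u' huv (e ▸ hz)
  · refine disjoint_left.1 (G.no_crossing u v u' v' huv huv' fun e => ?_) hz hz'
    rcases Sym2.eq_iff.1 e with ⟨rfl, rfl⟩ | ⟨rfl, rfl⟩
    exacts [hKL hu hu', hKL hu hv']

end

namespace IsBoundedIsoradial

variable {G : PlaneGraph} {h cp cd : ℝ}

/-- The boundary of a face is connected and consists of edges; if the corners were not connected to
each other along the boundary, it would split into two disjoint closed pieces. -/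
theorem connectedWithin_corners (H : G.IsBoundedIsoradial h cp cd) {F : Set ℂ} (hF : G.IsFace F)
    {u v : G.verts} (hu : (u : ℂ) ∈ G.corners F) (hv : (v : ℂ) ∈ G.corners F) :
    G.ConnectedWithin (G.corners F) u v := by
  by_contra hcon
  set K := {w : G.verts | (w : ℂ) ∈ G.corners F ∧ G.ConnectedWithin (G.corners F) u w} with hK
  set L := {w : G.verts | (w : ℂ) ∈ G.corners F ∧ ¬ G.ConnectedWithin (G.corners F) u w} with hL
  have hfin : {w : G.verts | (w : ℂ) ∈ G.corners F}.Finite :=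
    (hF.corners_finite H.iso).preimage Subtype.val_injective.injOn
  have hdisj : Disjoint K L := disjoint_left.2 fun w hw hw' => hw'.2 hw.2
  have hconn : IsPreconnected (frontier F) := by
    obtain ⟨e, -, -, he⟩ := exists_homeomorph_image_interior_closure_frontier_eq_unitBall
      (hF.convex H.iso) (by rw [(hF.isOpen H.iso).interior_eq]; exact hF.nonempty)
      (((hF.corners_finite H.iso).isCompact_convexHull ℝ).isBounded.subset
        (hF.subset_convexHull H.iso))
    rw [← e.isPreconnected_image, he]
    exact (isConnected_sphere (by rw [Complex.rank_real_complex]; norm_num) 0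
      zero_le_one).isPreconnected
  have hcover : frontier F ⊆ G.inducedSkeleton K ∪ G.inducedSkeleton L := by
    intro z hz
    have hvert : ∀ w : G.verts, (w : ℂ) = z → z ∈ G.inducedSkeleton K ∪ G.inducedSkeleton L := by
      rintro w rfl
      by_cases hw : G.ConnectedWithin (G.corners F) u w
      · exact Or.inl (vert_mem_inducedSkeleton ⟨⟨w.2, hz⟩, hw⟩)
      · exact Or.inr (vert_mem_inducedSkeleton ⟨⟨w.2, hz⟩, hw⟩)
    rcases hF.frontier_subset_skeleton H.iso hz with hz' | ⟨a, b, hab, hzab⟩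
    · exact hvert ⟨z, hz'⟩ rfl
    have hzab' := hzab
    rw [← insert_endpoints_openSegment, mem_insert_iff, mem_insert_iff] at hzab'
    rcases hzab' with e | e | hzo
    · exact hvert a e.symm
    · exact hvert b e.symm
    have hsub := H.segment_subset_frontier hab hF hzo (frontier_subset_closure hz)
    obtain ⟨ha, hb⟩ := corner_of_segment_subset hsub
    have hadj : G.ConnectedWithin (G.corners F) a b := .of_adj hab ha hb
    by_cases hw : G.ConnectedWithin (G.corners F) u a
    · exact Or.inl (segment_subset_inducedSkeleton (show a ∈ K from ⟨ha, hw⟩)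
        (show b ∈ K from ⟨hb, hw.trans hadj⟩) hab hzab)
    · exact Or.inr (segment_subset_inducedSkeleton (show a ∈ L from ⟨ha, hw⟩)
        (show b ∈ L from ⟨hb, fun hw' => hw (hw'.trans hadj.symm)⟩) hab hzab)
  obtain ⟨z, -, hz1, hz2⟩ := isPreconnected_closed_iff.1 hconn
    (G.inducedSkeleton K) (G.inducedSkeleton L)
    (isClosed_inducedSkeleton (hfin.subset fun w hw => hw.1))
    (isClosed_inducedSkeleton (hfin.subset fun w hw => hw.1)) hcover
    ⟨u, hu.2, vert_mem_inducedSkeleton (show u ∈ K from ⟨hu, .refl hu⟩)⟩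
    ⟨v, hv.2, vert_mem_inducedSkeleton (show v ∈ L from ⟨hv, hcon⟩)⟩
  exact disjoint_left.1 (disjoint_inducedSkeleton hdisj) hz1 hz2

theorem exists_corner (H : G.IsBoundedIsoradial h cp cd) {F : Set ℂ} (hF : G.IsFace F) :
    ∃ u : G.verts, (u : ℂ) ∈ G.corners F := by
  obtain ⟨u, hu⟩ := hF.corners_nonempty H.iso
  exact ⟨⟨u, hu.1⟩, hu⟩

/-- Two faces whose closures meet have a common corner. -/
theorem exists_common_corner (H : G.IsBoundedIsoradial h cp cd) {F F' : Set ℂ} (hF : G.IsFace F)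
    (hF' : G.IsFace F') {z : ℂ} (hz : z ∈ closure F) (hz' : z ∈ closure F') :
    ∃ u : G.verts, (u : ℂ) ∈ G.corners F ∧ (u : ℂ) ∈ G.corners F' := by
  by_cases hs : z ∈ G.skeleton
  · have hvert : ∀ w : G.verts, (w : ℂ) = z →
        ∃ u : G.verts, (u : ℂ) ∈ G.corners F ∧ (u : ℂ) ∈ G.corners F' := by
      rintro w rfl
      exact ⟨w, ⟨w.2, hF.mem_frontier H.iso hz hs⟩, ⟨w.2, hF'.mem_frontier H.iso hz' hs⟩⟩
    rcases hs with hs | ⟨a, b, hab, hzab⟩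
    · exact hvert ⟨z, hs⟩ rfl
    rw [← insert_endpoints_openSegment, mem_insert_iff, mem_insert_iff] at hzab
    rcases hzab with e | e | hzo
    · exact hvert a e.symm
    · exact hvert b e.symm
    · exact ⟨a, (corner_of_segment_subset (H.segment_subset_frontier hab hF hzo hz)).1,
        (corner_of_segment_subset (H.segment_subset_frontier hab hF' hzo hz')).1⟩
  · obtain ⟨F₀, hF₀, hz₀⟩ := exists_isFace_mem hs
    have heq : ∀ {F₁ : Set ℂ}, G.IsFace F₁ → z ∈ closure F₁ → F₁ = F₀ := by
      intro F₁ hF₁ hz₁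
      obtain ⟨w, hw₀, hw₁⟩ := mem_closure_iff.1 hz₁ F₀ (hF₀.isOpen H.iso) hz₀
      exact hF₁.eq_of_mem hF₀ hw₁ hw₀
    obtain ⟨u, hu⟩ := H.exists_corner hF
    exact ⟨u, hu, (heq hF hz).trans (heq hF' hz').symm ▸ hu⟩

/-- The segment from `u` to `v` is covered by closures of faces, and faces whose closures meet
have connected corners. -/
theorem connectedWithin_closedBall (H : G.IsBoundedIsoradial h cp cd) {u v : G.verts} {R : ℝ}
    (huv : dist (v : ℂ) u ≤ R) : G.ConnectedWithin (Metric.closedBall u (R + h)) u v := by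
  by_contra hcon
  set T := Metric.closedBall (u : ℂ) (R + h) with hT
  set S := {F | G.IsFace F ∧ G.corners F ⊆ T} with hS
  have hSfin : S.Finite := finite_faces_corners_subset H.iso u (R + h)
  set A := {F ∈ S | ∃ w : G.verts, (w : ℂ) ∈ G.corners F ∧ G.ConnectedWithin T u w} with hA
  set B := {F ∈ S | ∃ w : G.verts, (w : ℂ) ∈ G.corners F ∧ ¬ G.ConnectedWithin T u w} with hB
  have hu : (u : ℂ) ∈ T :=
    Metric.mem_closedBall_self (by linarith [H.pos, dist_nonneg.trans huv])
  have hface : ∀ z ∈ segment ℝ (u : ℂ) v, ∃ F ∈ S, z ∈ closure F := by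
    intro z hz
    obtain ⟨F, hF, hzF⟩ := exists_mem_closure H.iso z
    refine ⟨F, ⟨hF, fun w hw => ?_⟩, hzF⟩
    have hzR : z ∈ Metric.closedBall (u : ℂ) R := (convex_closedBall (u : ℂ) R).segment_subset
      (Metric.mem_closedBall_self (dist_nonneg.trans huv)) huv hz
    have h1 := hF.dist_le H.iso (IsFace.corners_subset_closure hw) hzF
    rw [hT, Metric.mem_closedBall]
    rw [Metric.mem_closedBall] at hzR
    linarith [dist_triangle w z u]
  have hcover : segment ℝ (u : ℂ) v ⊆ (⋃ F ∈ A, closure F) ∪ ⋃ F ∈ B, closure F := by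
    intro z hz
    obtain ⟨F, hF, hzF⟩ := hface z hz
    obtain ⟨w, hw⟩ := H.exists_corner hF.1
    by_cases hc : G.ConnectedWithin T u w
    · exact Or.inl (mem_biUnion (show F ∈ A from ⟨hF, w, hw, hc⟩) hzF)
    · exact Or.inr (mem_biUnion (show F ∈ B from ⟨hF, w, hw, hc⟩) hzF)
  have hend : ∀ {w : G.verts}, (w : ℂ) ∈ segment ℝ (u : ℂ) v →
      ∃ F ∈ S, (w : ℂ) ∈ closure F ∧ (w : ℂ) ∈ G.corners F := by
    intro w hw
    obtain ⟨F, hF, hwF⟩ := hface w hw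
    exact ⟨F, hF, hwF, w.2, hF.1.mem_frontier H.iso hwF (vert_mem_skeleton w)⟩
  obtain ⟨F, hF, huF, hcu⟩ := hend (left_mem_segment ℝ (u : ℂ) v)
  obtain ⟨F', hF', hvF', hcv⟩ := hend (right_mem_segment ℝ (u : ℂ) v)
  obtain ⟨z, -, hz1, hz2⟩ := isPreconnected_closed_iff.1
    (convex_segment (𝕜 := ℝ) (u : ℂ) (v : ℂ)).isPreconnected _ _
    ((hSfin.subset (sep_subset _ _)).isClosed_biUnion fun _ _ => isClosed_closure)
    ((hSfin.subset (sep_subset _ _)).isClosed_biUnion fun _ _ => isClosed_closure) hcover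
    ⟨u, left_mem_segment ℝ _ _, mem_biUnion (show F ∈ A from ⟨hF, u, hcu, .refl hu⟩) huF⟩
    ⟨v, right_mem_segment ℝ _ _, mem_biUnion (show F' ∈ B from ⟨hF', v, hcv, hcon⟩) hvF'⟩
  obtain ⟨F₁, ⟨hF₁, a, ha, hca⟩, hz1⟩ := mem_iUnion₂.1 hz1
  obtain ⟨F₂, ⟨hF₂, b, hb, hcb⟩, hz2⟩ := mem_iUnion₂.1 hz2
  obtain ⟨c, hc1, hc2⟩ := H.exists_common_corner hF₁.1 hF₂.1 hz1 hz2
  exact hcb ((hca.trans ((H.connectedWithin_corners hF₁.1 ha hc1).mono hF₁.2)).trans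
    ((H.connectedWithin_corners hF₂.1 hc2 hb).mono hF₂.2))

theorem exists_adj (H : G.IsBoundedIsoradial h cp cd) (u : G.verts) : ∃ v, G.graph.Adj u v := by
  obtain ⟨F, hF, hu⟩ := exists_mem_closure H.iso (u : ℂ)
  have huc : (u : ℂ) ∈ G.corners F := ⟨u.2, hF.mem_frontier H.iso hu (vert_mem_skeleton u)⟩
  obtain ⟨v, hv, hne⟩ : ∃ v : G.verts, (v : ℂ) ∈ G.corners F ∧ v ≠ u := by
    by_contra! hall
    refine hF.not_subset_hyperplane H.iso one_ne_zero (inner ℝ 1 (u : ℂ)) fun v hv => ?_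
    rw [← hall ⟨v, hv.1⟩ hv]
  obtain ⟨p, -⟩ := H.connectedWithin_corners hF huc hv
  exact ⟨_, p.adj_snd (SimpleGraph.Walk.not_nil_of_ne hne.symm)⟩

theorem exists_walk_length_le (H : G.IsBoundedIsoradial h cp cd) {u v : G.verts} {R : ℝ}
    (huv : dist (v : ℂ) u ≤ R * h) :
    ∃ p : G.graph.Walk u v, (p.length : ℝ) ≤ packConst cp cd (R + 1) := by
  classical
  obtain ⟨p, hp⟩ := H.connectedWithin_closedBall huv
  choose nb hnb using H.exists_adj
  refine ⟨p.toPath, ?_⟩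
  have hnodup := p.toPath.2.support_nodup
  set S := (p.toPath : G.graph.Walk u v).support.toFinset with hS
  have hcard : (p.toPath : G.graph.Walk u v).length + 1 = S.card := by
    rw [hS, List.toFinset_card_of_nodup hnodup, SimpleGraph.Walk.length_support]
  have hinj : Function.Injective fun w : G.verts => (w, nb w) := fun a b e => (Prod.mk.inj e).1
  have hle : (S.card : ℝ) ≤ packConst cp cd (R + 1) := by
    rw [← Finset.card_map ⟨_, hinj⟩]
    refine H.card_edges_le (p := u) _ (fun e he => ?_) fun e he => ?_ <;>
      obtain ⟨w, hw, rfl⟩ := Finset.mem_map.1 he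
    · exact hnb w
    · have := hp w (p.support_toPath_subset_support (List.mem_toFinset.1 hw))
      rw [Metric.mem_closedBall] at this
      exact this.trans_eq (by ring)
  rw [← hcard] at hle
  push_cast at hle
  linarith

theorem dist_nearestVertex_le (H : G.IsBoundedIsoradial h cp cd) {π : ℂ → G.verts}
    (hπ : G.IsNearestVertexMap π) (z : ℂ) : dist z (π z) ≤ h := by
  obtain ⟨F, hF, hz⟩ := exists_mem_closure H.iso z
  obtain ⟨u, hu⟩ := H.exists_corner hF
  exact (hπ z u).trans (hF.dist_le H.iso hz (IsFace.corners_subset_closure hu))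

/-- The straight line from `x` to `y` is followed in steps of length at most `h`. -/
theorem exists_walk_nearestVertex (H : G.IsBoundedIsoradial h cp cd) {π : ℂ → G.verts}
    (hπ : G.IsNearestVertexMap π) (x y : ℂ) :
    ∃ p : G.graph.Walk (π x) (π y),
      (p.length : ℝ) ≤ packConst cp cd 4 * (dist x y / h + 1) := by
  have hp := H.pos
  have key : ∀ n : ℕ, ∀ y : ℂ, dist x y ≤ n * h → ∃ p : G.graph.Walk (π x) (π y),
      (p.length : ℝ) ≤ packConst cp cd 4 * n := by
    intro n
    induction n with
    | zero =>
      intro y hy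
      obtain rfl : x = y := dist_le_zero.1 (by simpa using hy)
      exact ⟨.nil, by simp⟩
    | succ n ih =>
      intro y hy
      obtain ⟨y', h1, h2⟩ : ∃ y' : ℂ, dist x y' ≤ n * h ∧ dist y' y ≤ h := by
        refine ⟨AffineMap.lineMap x y ((n : ℝ) / (n + 1)), ?_, ?_⟩
        · rw [dist_left_lineMap, Real.norm_of_nonneg (by positivity), div_mul_eq_mul_div,
            div_le_iff₀ (by positivity)]
          push_cast at hy
          nlinarith [Nat.cast_nonneg (α := ℝ) n]
        · have e : 1 - (n : ℝ) / (n + 1) = 1 / (n + 1) := by field_simp; ring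
          rw [dist_lineMap_right, e, Real.norm_of_nonneg (by positivity), div_mul_eq_mul_div,
            div_le_iff₀ (by positivity), one_mul]
          push_cast at hy
          linarith
      obtain ⟨p, hp⟩ := ih y' h1
      have h3 : dist (π y : ℂ) (π y') ≤ 3 * h := by
        linarith [dist_triangle4 (π y : ℂ) y y' (π y'), H.dist_nearestVertex_le hπ y',
          H.dist_nearestVertex_le hπ y, dist_comm (π y : ℂ) y, dist_comm y y']
      obtain ⟨q, hq⟩ := H.exists_walk_length_le h3
      refine ⟨p.append q, ?_⟩
      rw [SimpleGraph.Walk.length_append]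
      norm_num at hq
      push_cast
      linarith
  obtain ⟨p, hp⟩ := key ⌈dist x y / h⌉₊ y (by
    rw [← div_le_iff₀ hp]
    exact Nat.le_ceil _)
  refine ⟨p, hp.trans ?_⟩
  have hc : 0 ≤ packConst cp cd 4 := sq_nonneg _
  gcongr
  exact (Nat.ceil_lt_add_one (by positivity)).le

theorem dist_le_length (H : G.IsBoundedIsoradial h cp cd) {u v : G.verts}
    (p : G.graph.Walk u v) : dist (u : ℂ) v ≤ p.length * h := by
  induction p with
  | nil => simp
  | @cons u v w huv p ih =>
    rw [SimpleGraph.Walk.length_cons]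
    push_cast
    linarith [dist_triangle (u : ℂ) v w, H.dist_le_of_adj huv]

theorem dist_le_graph_dist (H : G.IsBoundedIsoradial h cp cd) {π : ℂ → G.verts}
    (hπ : G.IsNearestVertexMap π) (x y : ℂ) :
    dist x y ≤ G.graph.dist (π x) (π y) * h + 2 * h := by
  obtain ⟨p, -⟩ := H.exists_walk_nearestVertex hπ x y
  obtain ⟨q, hq⟩ := p.reachable.exists_walk_length_eq_dist
  have := H.dist_le_length q
  rw [hq] at this
  linarith [dist_triangle4 x (π x) (π y) y, H.dist_nearestVertex_le hπ x,
    H.dist_nearestVertex_le hπ y, dist_comm (π y : ℂ) y]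

end IsBoundedIsoradial

end PlaneGraph

namespace PlaneGraph

/-! ### The heat kernel in the graph regime -/

/-- In units of `h⁻²`, a bound for the total jump rate at a vertex. -/
noncomputable def rateConst (cp cd : ℝ) : ℝ :=
  packConst cp cd 0 * (1 / (cp * sepConst cp cd ^ 2))

namespace IsBoundedIsoradial

variable {G : PlaneGraph} {h cp cd : ℝ}

theorem rateConst_pos (H : G.IsBoundedIsoradial h cp cd) : 0 < rateConst cp cd := by
  have h1 := H.sepConst_pos
  have h2 := H.cp_pos
  rw [rateConst, packConst]
  positivity

theorem mem_neighbors (H : G.IsBoundedIsoradial h cp cd) (u v : G.verts) :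
    v ∈ (H.finite_neighborSet u).toFinset ↔ G.graph.Adj u v := by simp

theorem rate_nonneg (H : G.IsBoundedIsoradial h cp cd) (u v : G.verts)
    (hv : v ∈ (H.finite_neighborSet u).toFinset) : 0 ≤ G.rate u v := by
  have := H.cd_pos
  exact le_trans (by positivity) (H.le_rate ((H.mem_neighbors u v).1 hv))

theorem solvesHeatEquation (H : G.IsBoundedIsoradial h cp cd) :
    G.SolvesHeatEquation G.heatKernel :=
  solvesHeatEquation_heatKernel H.mem_neighbors H.rate_nonneg H.sum_rate_le

theorem reachable (H : G.IsBoundedIsoradial h cp cd) (u v : G.verts) : G.graph.Reachable u v := by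
  obtain ⟨p, -⟩ := H.connectedWithin_closedBall (le_refl (dist (v : ℂ) u))
  exact p.reachable

theorem le_heatKernel (H : G.IsBoundedIsoradial h cp cd) (u v : G.verts) {t : ℝ} (ht : 0 ≤ t) :
    Real.exp (-(rateConst cp cd / h ^ 2 * (t / 2))) *
        ((cd / 4 / h ^ 2 * (t / 2)) ^ G.graph.dist u v / ((G.graph.dist u v).factorial : ℝ))
      ≤ G.heatKernel t u v := by
  rw [heatKernel_eq H.mem_neighbors]
  have := H.cd_pos
  exact le_expSeries_rateLaplacian (fun v w => (H.mem_neighbors v w).2) (by positivity)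
    (fun v w hw => H.le_rate ((H.mem_neighbors v w).1 hw)) H.sum_rate_le (abs_delta_le_one u)
    (delta_nonneg u) (delta_self u).ge (H.reachable u v) (by positivity)

theorem heatKernel_le (H : G.IsBoundedIsoradial h cp cd) (u v : G.verts) {t : ℝ} (ht : 0 ≤ t) :
    G.heatKernel t u v ≤ (2 * (rateConst cp cd / h ^ 2) * (t / 2)) ^ G.graph.dist u v /
        ((G.graph.dist u v).factorial : ℝ) *
      Real.exp (2 * (rateConst cp cd / h ^ 2) * (t / 2)) := by
  rw [heatKernel_eq H.mem_neighbors]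
  exact (le_abs_self _).trans (abs_expSeries_rateLaplacian_le
    (fun v w => (H.mem_neighbors v w).1) H.rate_nonneg H.sum_rate_le (abs_delta_le_one u)
    (fun _ => eq_of_delta_ne_zero) (by positivity) v)

theorem heatKernel_pos (H : G.IsBoundedIsoradial h cp cd) (u v : G.verts) {t : ℝ} (ht : 0 < t) :
    0 < G.heatKernel t u v := by
  have := H.cd_pos
  have := H.pos
  exact lt_of_lt_of_le (by positivity) (H.le_heatKernel u v ht.le)

theorem graph_dist_le (H : G.IsBoundedIsoradial h cp cd) {π : ℂ → G.verts}
    (hπ : G.IsNearestVertexMap π) (x y : ℂ) (h1 : h ≤ 1) :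
    (G.graph.dist (π x) (π y) : ℝ) ≤ packConst cp cd 4 * (dist x y + 1) / h := by
  obtain ⟨p, hp⟩ := H.exists_walk_nearestVertex hπ x y
  have hh := H.pos
  calc (G.graph.dist (π x) (π y) : ℝ) ≤ p.length := by exact_mod_cast SimpleGraph.dist_le p
    _ ≤ packConst cp cd 4 * (dist x y / h + 1) := hp
    _ ≤ packConst cp cd 4 * (dist x y / h + 1 / h) := by
        have hc : 0 ≤ packConst cp cd 4 := sq_nonneg _
        gcongr
        rwa [le_div_iff₀ hh, one_mul]
    _ = _ := by ring

theorem le_graph_dist (H : G.IsBoundedIsoradial h cp cd) {π : ℂ → G.verts}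
    (hπ : G.IsNearestVertexMap π) {x y : ℂ} (h1 : 4 * h ≤ dist x y) :
    dist x y / 2 / h ≤ (G.graph.dist (π x) (π y) : ℝ) := by
  rw [div_le_iff₀ H.pos]
  linarith [H.dist_le_graph_dist hπ x y]

end IsBoundedIsoradial

end PlaneGraph

theorem theorem4p1
    (Γ : ℝ → PlaneGraph)
    (hiso : ∀ h : ℝ, 0 < h → (Γ h).IsIsoradial h)
    (hprimal : ∃ cp : ℝ, 0 < cp ∧ ∀ h : ℝ, 0 < h → ∀ u v : (Γ h).verts,
      (Γ h).graph.Adj u v → cp * h ≤ (Γ h).edgeLength u v)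
    (hdual : ∃ cd : ℝ, 0 < cd ∧ ∀ h : ℝ, 0 < h → ∀ u v : (Γ h).verts,
      (Γ h).graph.Adj u v → cd * h ≤ (Γ h).dualEdgeLength u v)
    (π : ∀ h : ℝ, ℂ → (Γ h).verts)
    (hπ : ∀ h : ℝ, 0 < h → (Γ h).IsNearestVertexMap (π h))
    (x y : ℂ) (β t : ℝ) (hβ : 1 < β) (ht : 0 < t) :
    (∀ h : ℝ, 0 < h → (Γ h).SolvesHeatEquation (Γ h).heatKernel) ∧
    (∀ h : ℝ, 0 < h → 0 < (Γ h).heatKernel (h ^ β * t) (π h x) (π h y)) ∧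
    Tendsto (fun h : ℝ =>
      h / Real.log (h ^ (β - 1)) *
          Real.log ((Γ h).heatKernel (h ^ β * t) (π h x) (π h y))
        - h * ((Γ h).graph.dist (π h x) (π h y) : ℝ))
      (𝓝[>] 0) (𝓝 0) := by
  obtain ⟨cp, hcp, hp⟩ := hprimal
  obtain ⟨cd, hcd, hd⟩ := hdual
  have H : ∀ h : ℝ, 0 < h → (Γ h).IsBoundedIsoradial h cp cd := fun h hh =>
    ⟨hh, hcp, hcd, hiso h hh, hp h hh, hd h hh⟩
  refine ⟨fun h hh => (H h hh).solvesHeatEquation,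
    fun h hh => (H h hh).heatKernel_pos _ _ (by positivity), ?_⟩
  set Λ := PlaneGraph.rateConst cp cd
  have hΛ : 0 < Λ := (H 1 one_pos).rateConst_pos
  -- `K / h` bounds the graph distance from above, `k / h` from below unless it is zero
  set K := PlaneGraph.packConst cp cd 4 * (dist x y + 1) with hK
  have hK0 : 0 < K := by
    have := (H 1 one_pos).sepConst_pos
    rw [hK, PlaneGraph.packConst]
    positivity
  set k := if x = y then 1 else dist x y / 2 with hk
  have hk0 : 0 < k := by
    rw [hk]
    split_ifs with hxy
    · exact one_pos
    · exact half_pos (dist_pos.2 hxy)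
  have hpos : ∀ᶠ h in 𝓝[>] (0 : ℝ), 0 < h := self_mem_nhdsWithin
  have hsmall : ∀ ε : ℝ, 0 < ε → ∀ᶠ h in 𝓝[>] (0 : ℝ), h ≤ ε := fun ε hε =>
    nhdsWithin_le_nhds (Iic_mem_nhds hε)
  have hdK : ∀ᶠ h in 𝓝[>] (0 : ℝ), ((Γ h).graph.dist (π h x) (π h y) : ℝ) ≤ K / h := by
    filter_upwards [hpos, hsmall 1 one_pos] with h hh h1
    exact (H h hh).graph_dist_le (hπ h hh) x y h1
  have hdk : ∀ᶠ h in 𝓝[>] (0 : ℝ), (Γ h).graph.dist (π h x) (π h y) = 0 ∨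
      k / h ≤ ((Γ h).graph.dist (π h x) (π h y) : ℝ) := by
    by_cases hxy : x = y
    · exact Eventually.of_forall fun h => Or.inl (by rw [hxy, SimpleGraph.dist_self])
    · filter_upwards [hpos, hsmall (dist x y / 4) (by have := dist_pos.2 hxy; positivity)]
        with h hh h1
      refine Or.inr ?_
      rw [hk, if_neg hxy]
      exact (H h hh).le_graph_dist (hπ h hh) (by linarith)
  -- the time scale `h ^ β / h ^ 2` is at most `1 / h`, as `β > 1`
  have hscale : ∀ h : ℝ, 0 < h → h ^ β = h ^ (β - 1) * h := fun h hh => by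
    rw [Real.rpow_sub_one hh.ne']
    field_simp
  have hle1 : ∀ h : ℝ, 0 < h → h ≤ 1 → h ^ (β - 1) ≤ 1 := fun h hh h1 =>
    Real.rpow_le_one hh.le h1 (by linarith)
  refine tendsto_log_of_poisson_bounds (A := Λ * t) (c := cd * t / 8 / K)
    (C := Λ * t * Real.exp 1 / k) hβ (by positivity) (by positivity) hdK ?_ ?_
  · filter_upwards [hpos, hsmall 1 one_pos, hdK] with h hh h1 hd
    refine le_trans ?_ ((H h hh).le_heatKernel _ _ (by positivity))
    have hr : 0 < h ^ (β - 1) := Real.rpow_pos_of_pos hh _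
    have e : cd * t / 8 / K * h ^ (β - 1) = cd / 4 / h ^ 2 * (h ^ β * t / 2) / (K / h) := by
      rw [hscale h hh]
      field_simp
      ring
    rw [e]
    have he : Λ / h ^ 2 * (h ^ β * t / 2) ≤ Λ * t / h := by
      rw [hscale h hh, le_div_iff₀ hh]
      calc Λ / h ^ 2 * (h ^ (β - 1) * h * t / 2) * h = Λ * t / 2 * h ^ (β - 1) := by field_simp
        _ ≤ Λ * t / 2 * 1 := by gcongr; exact hle1 h hh h1
        _ ≤ Λ * t := by linarith [mul_pos hΛ ht]
    refine mul_le_mul (Real.exp_le_exp.2 (neg_le_neg he)) ?_ (by positivity) (by positivity)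
    exact le_pow_div_factorial (by positivity) hd
  · filter_upwards [hpos, hsmall 1 one_pos, hdk] with h hh h1 hd
    refine ((H h hh).heatKernel_le _ _ (by positivity)).trans ?_
    have hr : 0 < h ^ (β - 1) := Real.rpow_pos_of_pos hh _
    have e : Λ * t * Real.exp 1 / k * h ^ (β - 1)
        = 2 * (Λ / h ^ 2) * (h ^ β * t / 2) * Real.exp 1 / (k / h) := by
      rw [hscale h hh]
      field_simp
    rw [e, mul_comm]
    have he : 2 * (Λ / h ^ 2) * (h ^ β * t / 2) ≤ Λ * t / h := by
      rw [hscale h hh, le_div_iff₀ hh]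
      calc 2 * (Λ / h ^ 2) * (h ^ (β - 1) * h * t / 2) * h = Λ * t * h ^ (β - 1) := by field_simp
        _ ≤ Λ * t * 1 := by gcongr; exact hle1 h hh h1
        _ = Λ * t := mul_one _
    refine mul_le_mul (Real.exp_le_exp.2 he) ?_ (by positivity) (by positivity)
    exact pow_div_factorial_le (by positivity) (by positivity) hd
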